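/- Let $N\ge 1$ be a perfect square, let $k\ge 1$ be an integer, and let $f(z)=\sum_{n=1}^{\infty}a_f(n)e^{2\pi i n z}\in S_k(\Gamma_0(N))$ be a cusp form of weight $k$ for $\Gamma_0(N)$ whose Fourier coefficients $a_f(n)$ are all real or are all purely imaginary. Let $f|W_N\in S_k(\Gamma_0(N))$ be its image under the Fricke involution, $$(f|W_N)(z)=i^k N^{-k/2}z^{-k}f\!\left(-\frac{1}{Nz}\right),$$ and for $g\in S_k(\Gamma_0(N))$ with Fourier coefficients $a_g(n)$ let $L(s,g)$ be the entire function that is given by $\sum_{n\ge1}a_g(n)n^{-s}$ for $\operatorname{Re}(s)$ large. Fix a sign $\pm$, and suppose that the function $L(s,f)\pm L(s,f|W_N)$ is not identically zero. For $T>0$ let $\mathcal N_0^{\pm}(T)$ be the number of distinct zeros of odd order of $L(s,f)\pm L(s,f|W_N)$ of the form $s=\frac k2+it$ with $0\le t\le T$. Then there exists $d>0$ such that $$\liminf_{T\to\infty}\frac{\mathcal N_0^{\pm}(T)}{T}>d .$$ -/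

import Mathlib

open UpperHalfPlane CongruenceSubgroup Filter
open scoped Manifold

namespace FrickeZeros

noncomputable section

/-- The space `S_k(Γ₀(N))` of cusp forms of integral weight `k` and level `Γ₀(N)`
(trivial character). -/
abbrev Cusp (N : ℕ) (k : ℤ) : Type :=
  CuspForm (Gamma0 N : Subgroup (Matrix.GeneralLinearGroup (Fin 2) ℝ)) k

/-- The Fourier coefficient `a_f(n)` in `f(z) = ∑ a_f(n) e^{2πinz}`. -/
def coeff {N : ℕ} {k : ℤ} (f : Cusp N k) (n : ℕ) : ℂ :=
  (qExpansion 1 f).coeff n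

/-- The point `-1/(Nz)` of the upper half plane. -/
def frickePoint (N : ℕ) [NeZero N] (z : ℍ) : ℍ :=
  ⟨-1 / ((N : ℂ) * z), by
    have hN : (0 : ℝ) < N := Nat.cast_pos.mpr (Nat.pos_of_ne_zero (NeZero.ne N))
    have h : 0 < Complex.normSq ((N : ℂ) * z) :=
      Complex.normSq_pos.mpr (mul_ne_zero (by exact_mod_cast hN.ne') z.ne_zero)
    have : (-1 / ((N : ℂ) * z)).im = N * z.im / Complex.normSq ((N : ℂ) * z) := by
      rw [Complex.div_im]
      simp
      ring
    rw [this]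
    exact div_pos (mul_pos hN z.im_pos) h⟩

/-- The function `(f|W_N)(z) = i^k N^{-k/2} z^{-k} f(-1/(Nz))`. -/
def frickeFun (N : ℕ) [NeZero N] (k : ℤ) (f : ℍ → ℂ) (z : ℍ) : ℂ :=
  Complex.I ^ k * (((N : ℝ) ^ (-(k : ℝ) / 2) : ℝ) : ℂ) * (z : ℂ) ^ (-k) * f (frickePoint N z)

/-- The matrix `(0, -1; N, 0)`. -/
def frickeMatrix (N : ℕ) [NeZero N] : Matrix.GeneralLinearGroup (Fin 2) ℝ :=
  Matrix.GeneralLinearGroup.mkOfDetNeZero !![0, -1; (N : ℝ), 0]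
    (by simp [Matrix.det_fin_two, NeZero.ne N])

lemma frickeMatrix_smul (N : ℕ) [NeZero N] (z : ℍ) :
    frickeMatrix N • z = frickePoint N z := by
  have hN : (0 : ℝ) < N := Nat.cast_pos.mpr (Nat.pos_of_ne_zero (NeZero.ne N))
  ext
  rw [coe_smul_of_det_pos (by
    simpa [frickeMatrix, Matrix.GeneralLinearGroup.mkOfDetNeZero, Matrix.det_fin_two] using hN)]
  simp [frickeMatrix, frickePoint, num, denom, Matrix.GeneralLinearGroup.mkOfDetNeZero]

open scoped ModularForm in
/-- The Fricke operator is, up to a constant, the slash operator of `(0, -1; N, 0)`. -/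
lemma frickeFun_eq_smul (N : ℕ) [NeZero N] (k : ℤ) (f : ℍ → ℂ) :
    frickeFun N k f =
      (Complex.I ^ k * (((N : ℝ) ^ (-(k : ℝ) / 2) : ℝ) : ℂ) * (N : ℂ)) •
        (f ∣[k] frickeMatrix N) := by
  have hN : (0 : ℝ) < N := Nat.cast_pos.mpr (Nat.pos_of_ne_zero (NeZero.ne N))
  have hN' : (N : ℂ) ≠ 0 := by exact_mod_cast hN.ne'
  have hdet : (frickeMatrix N).det.val = N := by
    simp [frickeMatrix, Matrix.GeneralLinearGroup.mkOfDetNeZero, Matrix.det_fin_two]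
  have hden (z : ℍ) : denom (frickeMatrix N) z = N * z := by
    simp [frickeMatrix, denom, Matrix.GeneralLinearGroup.mkOfDetNeZero]
  funext z
  have hs (w : ℂ) : σ (frickeMatrix N) w = w := by
    rw [σ, if_pos (by rw [hdet]; exact hN)]
    rfl
  rw [Pi.smul_apply, ModularForm.slash_apply, frickeMatrix_smul, hden, hdet, hs]
  simp only [frickeFun, smul_eq_mul, abs_of_pos hN, mul_zpow]
  have : (N : ℂ) * ((N : ℂ) ^ (k - 1) * (N : ℂ) ^ (-k)) = 1 := by
    rw [← zpow_add₀ hN', ← zpow_one_add₀ hN',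
      show 1 + (k - 1 + -k) = 0 by ring, zpow_zero]
  rw [Complex.ofReal_natCast]
  linear_combination (-(Complex.I ^ k * (((N : ℝ) ^ (-(k : ℝ) / 2) : ℝ) : ℂ) * (z : ℂ) ^ (-k) *
    f (frickePoint N z))) * this

/-- The conjugate of an element of `Γ₀(N)` by `(0, -1; N, 0)` or by its inverse. -/
lemma exists_frickeMatrix_comm (N : ℕ) [NeZero N] {γ : Matrix.SpecialLinearGroup (Fin 2) ℤ}
    (hγ : γ ∈ Gamma0 N) : ∃ δ ∈ Gamma0 N,
      frickeMatrix N * Matrix.SpecialLinearGroup.mapGL ℝ γ =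
        Matrix.SpecialLinearGroup.mapGL ℝ δ * frickeMatrix N ∧
      Matrix.SpecialLinearGroup.mapGL ℝ γ * frickeMatrix N =
        frickeMatrix N * Matrix.SpecialLinearGroup.mapGL ℝ δ := by
  rw [Gamma0_mem, ZMod.intCast_zmod_eq_zero_iff_dvd] at hγ
  obtain ⟨e, he⟩ := hγ
  have hdet := γ.det_coe
  rw [Matrix.det_fin_two, he] at hdet
  have heR : ((γ 1 0 : ℤ) : ℝ) = N * e := by exact_mod_cast congrArg (Int.cast (R := ℝ)) he
  obtain ⟨δ, h00, h01, h10, h11⟩ : ∃ δ : Matrix.SpecialLinearGroup (Fin 2) ℤ,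
      δ 0 0 = γ 1 1 ∧ δ 0 1 = -e ∧ δ 1 0 = -(γ 0 1 * N) ∧ δ 1 1 = γ 0 0 :=
    ⟨⟨!![γ 1 1, -e; -(γ 0 1 * N), γ 0 0], by
      rw [Matrix.det_fin_two_of]; linear_combination hdet⟩, rfl, rfl, rfl, rfl⟩
  refine ⟨δ, ?_, ?_, ?_⟩
  · rw [Gamma0_mem, h10]
    simp
  · ext i j
    fin_cases i <;> fin_cases j <;>
      simp [frickeMatrix, Matrix.GeneralLinearGroup.mkOfDetNeZero, Matrix.mul_apply,
        Fin.sum_univ_two, heR, h00, h01, h10, h11, mul_comm]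
  · ext i j
    fin_cases i <;> fin_cases j <;>
      simp [frickeMatrix, Matrix.GeneralLinearGroup.mkOfDetNeZero, Matrix.mul_apply,
        Fin.sum_univ_two, heR, h00, h01, h10, h11, mul_comm]

open ConjAct Pointwise in
/-- The matrix `(0, -1; N, 0)` normalizes `Γ₀(N)`. -/
lemma frickeMatrix_conj (N : ℕ) [NeZero N] :
    toConjAct (frickeMatrix N)⁻¹ •
        (Gamma0 N : Subgroup (Matrix.GeneralLinearGroup (Fin 2) ℝ)) =
      (Gamma0 N : Subgroup (Matrix.GeneralLinearGroup (Fin 2) ℝ)) := by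
  ext x
  rw [Subgroup.mem_pointwise_smul_iff_inv_smul_mem, ← toConjAct_inv, inv_inv, toConjAct_smul]
  constructor
  · rintro ⟨γ, hγ, h⟩
    obtain ⟨δ, hδ, -, h2⟩ := exists_frickeMatrix_comm N hγ
    refine ⟨δ, hδ, ?_⟩
    rw [h, inv_mul_cancel_right] at h2
    exact (mul_left_cancel h2).symm
  · rintro ⟨γ, hγ, rfl⟩
    obtain ⟨δ, hδ, h1, -⟩ := exists_frickeMatrix_comm N hγ
    exact ⟨δ, hδ, by rw [h1, mul_inv_cancel_right]⟩

/-- The Fricke involution `f ↦ f|W_N` on `S_k(Γ₀(N))`. -/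
def fricke {N : ℕ} [NeZero N] {k : ℤ} (f : Cusp N k) : Cusp N k where
  toFun := frickeFun N k f
  slash_action_eq' γ hγ := by
    have hdet : Matrix.GeneralLinearGroup.det γ = 1 := by
      obtain ⟨δ, -, rfl⟩ := hγ
      simp
    rw [← frickeMatrix_conj N] at hγ
    have h := (CuspForm.translate f (frickeMatrix N)).slash_action_eq' γ hγ
    have hs (w : ℂ) : σ γ w = w := by
      rw [σ, if_pos (by simp [hdet])]
      rfl
    rw [frickeFun_eq_smul, ModularForm.smul_slash, hs]
    exact congrArg _ h
  holo' := by
    have h := (CuspForm.translate f (frickeMatrix N)).holo'.const_smul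
      (Complex.I ^ k * (((N : ℝ) ^ (-(k : ℝ) / 2) : ℝ) : ℂ) * (N : ℂ))
    change MDiff (frickeFun N k f)
    rw [frickeFun_eq_smul]
    exact h
  zero_at_cusps' {c} hc := by
    rw [← frickeMatrix_conj N] at hc
    intro g hg
    rw [frickeFun_eq_smul, ModularForm.smul_slash]
    exact Filter.ZeroAtFilter.smul _
      ((CuspForm.translate f (frickeMatrix N)).zero_at_cusps' hc g hg)

/-- The Hecke `L`-function of a cusp form for `Γ₀(N)`: the entire function which for large `Re s`
is the sum `∑_{n ≥ 1} a_f(n) n^{-s}`, see `LFun_eq_LSeries` and `differentiable_LFun`. -/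
def LFun {N : ℕ} [NeZero N] {k : ℤ} (hk : 0 < k) (f : Cusp N k) : ℂ → ℂ :=
  ModularForm.L hk f

lemma LFun_eq_LSeries {N : ℕ} [NeZero N] {k : ℤ} (hk : 0 < k) (f : Cusp N k) {s : ℂ}
    (hs : (k : ℝ) / 2 + 1 < s.re) :
    LSeriesSummable (coeff f) s ∧ LFun hk f s = LSeries (coeff f) s := by
  have h := CuspForm.hasSum_L hk f hs
  rw [strictWidthInfty_Gamma0, Complex.ofReal_one, Complex.one_cpow, one_mul] at h
  have h0 : coeff f 0 = 0 :=
    CuspFormClass.qExpansion_coeff_zero f one_pos (by simp)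
  have hterm : (fun n : ℕ => (qExpansion 1 f).coeff n / (n : ℂ) ^ s) =
      LSeries.term (coeff f) s := by
    funext n
    rcases eq_or_ne n 0 with rfl | hn
    · rw [LSeries.term_zero]
      change coeff f 0 / _ = 0
      rw [h0, zero_div]
    · rw [LSeries.term_of_ne_zero hn]
      rfl
  rw [hterm] at h
  exact ⟨h.summable, h.tsum_eq.symm⟩

lemma differentiable_LFun {N : ℕ} [NeZero N] {k : ℤ} (hk : 0 < k) (f : Cusp N k) :
    Differentiable ℂ (LFun hk f) :=
  CuspForm.differentiable_L hk f

/-- `F` has a zero of odd order at `s`. -/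
def IsOddZero (F : ℂ → ℂ) (s : ℂ) : Prop :=
  ∃ m : ℕ, Odd m ∧ analyticOrderAt F s = m

/-- The number of (distinct) zeros of odd order of `F` of the form `σ + it` with `0 ≤ t ≤ T`. -/
def oddZeroCount (F : ℂ → ℂ) (σ T : ℝ) : ℕ :=
  {t : ℝ | 0 ≤ t ∧ t ≤ T ∧ IsOddZero F ((σ : ℂ) + (t : ℂ) * Complex.I)}.ncard

end

end FrickeZeros

/-! This is the Hardy–Littlewood method for a positive density of sign changes. Put `g = f + ε
f|W_N` and `F(w) = g(iw/√N)` on `Re w > 0`. Since `ε² = 1`, `F(w⁻¹) = ε w^k F(w)`; and the Fourier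
coefficients of `f` are real up to a common constant. Hence the completed function `A^s Γ(s) L(s)`,
the Mellin transform of `F`, has constant phase modulo sign on `Re s = k/2`, and its odd-order zeros
there are its sign changes.

Fix `T` and replace the ray `y > 0` by the ray through `w = e^{i(π/2 - 1/T)}`. The Mellin transform
acquires the factor `w^{-s}`, of size `e^{(π/2 - 1/T)t}`, which offsets the decay `e^{-πt/2}` of `Γ`
for `T ≤ t ≤ 3T` (`exists_norm_L_le`). On the critical line the rotated transform is therefore at
least of order `T^{(k-1)/2} |L|`, and its phase is still constant.

Suppose a window `[t, t+H]` contains no odd zero. Then the modulus of the integral of the rotated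
transform over it equals the integral of the modulus (`integral_norm_eq_norm_integral`). The latter
is large: by Cauchy's theorem on a rectangle, the integral of `|n₀^s L(s)|` over the window is at
least a constant times `H`, minus the horizontal sides, because `n₀^s L(s)` is close to its leading
coefficient far to the right. The horizontal sides are bounded in mean over `t`
(`exists_integral_integral_norm_le`).

On the other hand, Plancherel in `log y` bounds the mean square over `t` of the window integral by
`B H T^k` (`exists_integral_norm_sq_integral_le`), so on average the integral is only of order `√H
T^{(k-1)/2}`. For a large constant `H` the two are incompatible for at least half of the `t` in `[T,
2T]`. Each odd zero meets windows starting in a set of measure `H`, so there are at least `T/(2H)`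
of them (`exists_half_le_mul_ncard`).

`IsRotatedMellin` collects what the analytic argument needs to know about `F` and `L`. -/

/-! ### Plancherel's theorem on `L¹ ∩ L²` -/

section Plancherel

open MeasureTheory FourierTransform SchwartzMap
open scoped ContDiff

/-- On `L¹ ∩ L²`, the `L²`-Fourier transform is given by the Fourier integral. -/
lemma fourier_toLp_ae_eq {f : ℝ → ℂ} (h1 : Integrable f) (h2 : MemLp f 2) :
    (𝓕 (h2.toLp f) : Lp ℂ 2 (volume : Measure ℝ)) =ᵐ[volume] 𝓕 f := by
  have hloc : LocallyIntegrable (𝓕 f) (volume : Measure ℝ) :=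
    (VectorFourier.fourierIntegral_continuous Real.continuous_fourierChar
      (by fun_prop) h1).locallyIntegrable
  -- It suffices to test against smooth compactly supported functions. Both transforms can be moved
  -- onto the test function: the `L²` one as a tempered distribution, the integral one by Fubini.
  refine ae_eq_of_integral_contDiff_smul_eq
    ((Lp.memLp _).locallyIntegrable (by norm_num)) hloc fun g hg hgc => ?_
  have hgC : ContDiff ℝ ∞ (fun x => (g x : ℂ)) := Complex.ofRealCLM.contDiff.comp hg
  have hgcC : HasCompactSupport (fun x => (g x : ℂ)) := hgc.comp_left Complex.ofReal_zero
  let φ : 𝓢(ℝ, ℂ) := hgcC.toSchwartzMap hgC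
  have hφ (x : ℝ) : φ x = g x := rfl
  have e1 := congrArg (fun u : TemperedDistribution ℝ ℂ => u φ)
    (Lp.fourier_toTemperedDistribution_eq (h2.toLp f))
  simp only [TemperedDistribution.fourier_apply, Lp.toTemperedDistribution_apply] at e1
  have e2 : ∫ x, (𝓕 φ) x • (h2.toLp f) x = ∫ x, (𝓕 φ) x • f x := by
    refine integral_congr_ae ?_
    filter_upwards [h2.coeFn_toLp] with x hx
    rw [hx]
  have e3 : ∫ x, (𝓕 (φ : ℝ → ℂ)) x • f x = ∫ x, φ x • (𝓕 f) x := by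
    have := VectorFourier.integral_fourierIntegral_smul_eq_flip (μ := volume) (ν := volume)
      (L := innerₗ ℝ) Real.continuous_fourierChar (by fun_prop) (φ.integrable (μ := volume)) h1
    rwa [flip_innerₗ] at this
  rw [e2, SchwartzMap.fourier_coe, e3] at e1
  simpa only [hφ, Complex.real_smul, smul_eq_mul] using e1.symm

/-- Plancherel's theorem on `L¹ ∩ L²`. -/
lemma integral_norm_sq_fourier {f : ℝ → ℂ} (h1 : Integrable f) (h2 : MemLp f 2) :
    MemLp (𝓕 f) 2 (volume : Measure ℝ) ∧ ∫ x, ‖𝓕 f x‖ ^ 2 = ∫ x, ‖f x‖ ^ 2 := by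
  have hae := fourier_toLp_ae_eq h1 h2
  have hm : MemLp (𝓕 f) 2 (volume : Measure ℝ) := (memLp_congr_ae hae).1 (Lp.memLp _)
  refine ⟨hm, ?_⟩
  have hn : eLpNorm (𝓕 f) 2 (volume : Measure ℝ) = eLpNorm f 2 volume := by
    rw [← eLpNorm_congr_ae hae, ← eLpNorm_congr_ae h2.coeFn_toLp]
    have := Lp.norm_fourier_eq (h2.toLp f)
    rw [Lp.norm_def, Lp.norm_def, ENNReal.toReal_eq_toReal_iff' (Lp.eLpNorm_ne_top _)
      (Lp.eLpNorm_ne_top _)] at this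
    exact this
  rw [hm.eLpNorm_eq_integral_rpow_norm (by norm_num) (by norm_num),
    h2.eLpNorm_eq_integral_rpow_norm (by norm_num) (by norm_num),
    ENNReal.ofReal_eq_ofReal_iff (by positivity) (by positivity)] at hn
  simp only [ENNReal.toReal_ofNat, Real.rpow_ofNat] at hn
  exact (Real.rpow_left_inj (by positivity) (by positivity) (by norm_num)).1 hn

/-- Plancherel's theorem for `t ↦ ∫ f(x) e^{itx} dx`. -/
lemma integral_norm_sq_integral_mul_exp {f : ℝ → ℂ} (h1 : Integrable f) (h2 : MemLp f 2) :
    Integrable (fun t : ℝ => ‖∫ x : ℝ, f x * Complex.exp (t * x * Complex.I)‖ ^ 2) ∧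
      ∫ t : ℝ, ‖∫ x : ℝ, f x * Complex.exp (t * x * Complex.I)‖ ^ 2 =
        2 * Real.pi * ∫ x, ‖f x‖ ^ 2 := by
  obtain ⟨hm, he⟩ := integral_norm_sq_fourier h1 h2
  have key (t : ℝ) : ∫ x : ℝ, f x * Complex.exp (t * x * Complex.I) =
      𝓕 f (t * (-(2 * Real.pi)⁻¹)) := by
    rw [Real.fourier_eq']
    refine integral_congr_ae (Eventually.of_forall fun x => ?_)
    simp only [smul_eq_mul, RCLike.inner_apply, conj_trivial]
    rw [mul_comm]
    congr 2
    push_cast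
    have : (Real.pi : ℂ) ≠ 0 := by exact_mod_cast Real.pi_ne_zero
    field_simp
  simp only [key]
  have hne : -(2 * Real.pi)⁻¹ ≠ 0 := by
    have := Real.pi_pos
    exact neg_ne_zero.2 (by positivity)
  have hi : Integrable (fun t : ℝ => ‖𝓕 f t‖ ^ 2) := hm.integrable_norm_pow (by norm_num)
  refine ⟨hi.comp_mul_right' hne, ?_⟩
  -- The change of variable `t ↦ -t/(2π)` to the normalisation of `𝓕` produces the factor `2π`.
  rw [Measure.integral_comp_mul_right (fun t : ℝ => ‖𝓕 f t‖ ^ 2), he]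
  rw [inv_neg, inv_inv, abs_neg, abs_of_pos Real.two_pi_pos, smul_eq_mul]

end Plancherel

/-! ### A lower bound for `Γ` on vertical lines, from Euler's product -/

section GammaLowerBound

open Complex Topology

/-- A reverse weighted AM-GM inequality. -/
lemma one_add_mul_le_rpow_mul {a x : ℝ} (ha0 : 0 ≤ a) (ha1 : a ≤ 1) (hx : 0 ≤ x) :
    1 + a * x ≤ (1 + x) ^ a * (1 + x ^ 2) := by
  -- Multiplying the claim by `(1 + x) ^ (1 - a)` clears the real power; Bernoulli's inequality for
  -- this factor leaves a polynomial inequality.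
  have h1 : (1 + x) ^ (1 - a) ≤ 1 + (1 - a) * x :=
    rpow_one_add_le_one_add_mul_self (by linarith) (by linarith) (by linarith)
  have hp : 0 < (1 + x) ^ a := by positivity
  have h2 : (1 + x) ^ a * (1 + x) ^ (1 - a) = 1 + x := by
    rw [← Real.rpow_add (by linarith)]; simp
  have h3 : 0 < (1 + x) ^ (1 - a) := by positivity
  refine le_of_mul_le_mul_right ?_ h3
  calc (1 + a * x) * (1 + x) ^ (1 - a) ≤ (1 + a * x) * (1 + (1 - a) * x) := by gcongr
    _ ≤ (1 + x) * (1 + x ^ 2) := by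
      have : 0 ≤ a * (1 - a) := mul_nonneg ha0 (by linarith)
      have : a * (1 - a) ≤ 1 := by nlinarith
      nlinarith [pow_nonneg hx 3, sq_nonneg x]
    _ = (1 + x) ^ a * (1 + x ^ 2) * (1 + x) ^ (1 - a) := by linear_combination -(1 + x ^ 2) * h2

/-- With `A_j = (1/2 + j)² + t²`, the shifted factor is nearly the geometric interpolation
`A_j^(1-a) A_{j+1}^a`. The loss is `1 + x²` with `x = A_{j+1}/A_j - 1 = O(1/(j+1))`, so the product
of the losses over `j` is bounded uniformly in `t ≥ 1`. -/
lemma sq_add_sq_le_rpow_mul_exp {a t : ℝ} (ha0 : 0 ≤ a) (ha1 : a ≤ 1) (ht : 1 ≤ t) (j : ℕ) :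
    (1 / 2 + a + j) ^ 2 + t ^ 2 ≤ ((1 / 2 + j : ℝ) ^ 2 + t ^ 2) *
      (((1 / 2 + (j + 1 : ℕ) : ℝ) ^ 2 + t ^ 2) / ((1 / 2 + j : ℝ) ^ 2 + t ^ 2)) ^ a *
        Real.exp (32 / ((j : ℝ) + 1) ^ 2) := by
  have hj : (0 : ℝ) ≤ j := j.cast_nonneg
  set A : ℝ := (1 / 2 + j) ^ 2 + t ^ 2 with hA
  have hA0 : 0 < A := by positivity
  set x : ℝ := (2 * j + 2) / A with hx
  have hx0 : 0 ≤ x := by positivity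
  have hAx : A * x = 2 * j + 2 := by rw [hx]; field_simp
  have hq : ((1 / 2 + (j + 1 : ℕ) : ℝ) ^ 2 + t ^ 2) / A = 1 + x := by
    rw [div_eq_iff hA0.ne', add_mul, mul_comm x, hAx, hA]; push_cast; ring
  have hxe : 1 + x ^ 2 ≤ Real.exp (32 / ((j : ℝ) + 1) ^ 2) := by
    refine le_trans ?_ (Real.add_one_le_exp _)
    rw [add_comm]
    gcongr
    rw [hx, div_pow, div_le_div_iff₀ (by positivity) (by positivity)]
    have h1 : ((j : ℝ) + 1) ^ 2 ≤ 2 * A := by rw [hA]; nlinarith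
    have h2 : ((j : ℝ) + 1) ^ 2 * ((j : ℝ) + 1) ^ 2 ≤ (2 * A) * (2 * A) := by gcongr
    nlinarith
  rw [hq]
  calc (1 / 2 + a + j) ^ 2 + t ^ 2 ≤ A * (1 + a * x) := by
        rw [mul_add, mul_left_comm, hAx, hA]; nlinarith
    _ ≤ A * ((1 + x) ^ a * (1 + x ^ 2)) := by
        gcongr; exact one_add_mul_le_rpow_mul ha0 ha1 hx0
    _ ≤ A * ((1 + x) ^ a * Real.exp (32 / ((j : ℝ) + 1) ^ 2)) := by gcongr
    _ = _ := by ring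

/-- The ratios of consecutive factors, raised to the power `a`, telescope. -/
lemma prod_sq_add_sq_le {a t : ℝ} (ha0 : 0 ≤ a) (ha1 : a ≤ 1) (ht : 1 ≤ t) (n : ℕ) :
    ∏ j ∈ Finset.range n, ((1 / 2 + a + j) ^ 2 + t ^ 2) ≤
      (∏ j ∈ Finset.range n, ((1 / 2 + j : ℝ) ^ 2 + t ^ 2)) *
      (((1 / 2 + n : ℝ) ^ 2 + t ^ 2) / ((1 / 2 : ℝ) ^ 2 + t ^ 2)) ^ a *
        Real.exp (∑ j ∈ Finset.range n, 32 / ((j : ℝ) + 1) ^ 2) := by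
  induction n with
  | zero => simp [div_self (show ((2 : ℝ) ^ 2)⁻¹ + t ^ 2 ≠ 0 by positivity)]
  | succ n ih =>
    rw [Finset.prod_range_succ, Finset.prod_range_succ, Finset.sum_range_succ, Real.exp_add]
    refine (mul_le_mul ih (sq_add_sq_le_rpow_mul_exp ha0 ha1 ht n) (by positivity)
      (by positivity)).trans (le_of_eq ?_)
    have hA : 0 < (1 / 2 + n : ℝ) ^ 2 + t ^ 2 := by positivity
    have : (((1 / 2 + (n + 1 : ℕ) : ℝ) ^ 2 + t ^ 2) / ((1 / 2 : ℝ) ^ 2 + t ^ 2)) ^ a =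
        (((1 / 2 + n : ℝ) ^ 2 + t ^ 2) / ((1 / 2 : ℝ) ^ 2 + t ^ 2)) ^ a *
        (((1 / 2 + (n + 1 : ℕ) : ℝ) ^ 2 + t ^ 2) / ((1 / 2 + n : ℝ) ^ 2 + t ^ 2)) ^ a := by
      rw [← Real.mul_rpow (by positivity) (by positivity)]
      congr 1
      field_simp
    rw [this]
    ring

lemma norm_sq_GammaSeq {σ t : ℝ} {n : ℕ} (hn : n ≠ 0) :
    ‖GammaSeq (σ + t * Complex.I) n‖ ^ 2 = (n : ℝ) ^ (2 * σ) * (n.factorial : ℝ) ^ 2 /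
      ∏ j ∈ Finset.range (n + 1), ((σ + j) ^ 2 + t ^ 2) := by
  have hn' : (0 : ℝ) < n := by exact_mod_cast Nat.pos_of_ne_zero hn
  rw [GammaSeq, norm_div, norm_mul, norm_prod, div_pow, mul_pow, ← Finset.prod_pow]
  congr 1
  · rw [← ofReal_natCast, norm_cpow_eq_rpow_re_of_pos hn', Complex.norm_natCast,
      ← Real.rpow_natCast, ← Real.rpow_mul hn'.le]
    simp [mul_comm]
  · refine Finset.prod_congr rfl fun j _ => ?_
    rw [← normSq_eq_norm_sq, normSq_apply]
    simp
    ring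

/-- `‖Γ(1/2 + a + it)‖ ≫ t ^ a ‖Γ(1/2 + it)‖`, uniformly for `0 ≤ a ≤ 1` and `t ≥ 1`. -/
lemma exists_mul_rpow_mul_norm_Gamma_le : ∃ c : ℝ, 0 < c ∧ ∀ a t : ℝ, 0 ≤ a → a ≤ 1 → 1 ≤ t →
    c * t ^ a * ‖Complex.Gamma (1 / 2 + t * Complex.I)‖ ≤ ‖Complex.Gamma ((1 / 2 + a : ℝ) + t * Complex.I)‖ := by
  have hsum : Summable fun j : ℕ => 32 / ((j : ℝ) + 1) ^ 2 := by
    have := (summable_nat_add_iff 1).2 (Real.summable_one_div_nat_pow.2 (by norm_num : 1 < 2))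
    simpa [div_eq_mul_inv] using this.mul_left 32
  set K := ∑' j : ℕ, 32 / ((j : ℝ) + 1) ^ 2
  refine ⟨Real.exp (-K / 2), Real.exp_pos _, fun a t ha0 ha1 ht => ?_⟩
  have ht0 : 0 < t := by linarith
  have hsq : Real.exp (-K) * (t ^ 2) ^ a * ‖Complex.Gamma ((1 / 2 : ℝ) + t * Complex.I)‖ ^ 2 ≤
      ‖Complex.Gamma ((1 / 2 + a : ℝ) + t * Complex.I)‖ ^ 2 := by
    have l1 := ((GammaSeq_tendsto_Gamma ((1 / 2 : ℝ) + t * Complex.I)).norm.pow 2)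
    have l2 := ((GammaSeq_tendsto_Gamma ((1 / 2 + a : ℝ) + t * Complex.I)).norm.pow 2)
    -- The telescoped product ends in `((3/2 + n)² + t²)^a`, whereas Euler's limit supplies
    -- `n^(2a)`; the quotient tends to `1` and is inserted as a correction.
    have l3 : Tendsto (fun n : ℕ => ((1 / 2 + (n + 1 : ℕ) : ℝ) ^ 2 + t ^ 2) / (n : ℝ) ^ 2)
        atTop (𝓝 1) := by
      have h0 : Tendsto (fun n : ℕ => (n : ℝ)⁻¹) atTop (𝓝 0) := tendsto_inv_atTop_nhds_zero_nat
      have : Tendsto (fun n : ℕ => (3 / 2 * (n : ℝ)⁻¹ + 1) ^ 2 + t ^ 2 * ((n : ℝ)⁻¹) ^ 2)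
          atTop (𝓝 ((3 / 2 * 0 + 1) ^ 2 + t ^ 2 * 0 ^ 2)) := by
        exact (((h0.const_mul _).add_const _).pow 2).add ((h0.pow 2).const_mul _)
      norm_num at this
      refine this.congr' ?_
      filter_upwards [eventually_ne_atTop 0] with n hn
      have : (n : ℝ) ≠ 0 := by exact_mod_cast hn
      push_cast
      field_simp
      ring
    have l4 := l3.rpow_const (p := a) (Or.inl one_ne_zero)
    have l5 := l2.mul l4
    rw [Real.one_rpow, mul_one] at l5
    refine le_of_tendsto_of_tendsto (l1.const_mul (Real.exp (-K) * (t ^ 2) ^ a)) l5 ?_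
    filter_upwards [eventually_ne_atTop 0] with n hn
    have hn' : (0 : ℝ) < n := by exact_mod_cast Nat.pos_of_ne_zero hn
    rw [norm_sq_GammaSeq hn, norm_sq_GammaSeq hn]
    have hp := prod_sq_add_sq_le ha0 ha1 ht (n + 1)
    have hK : ∑ j ∈ Finset.range (n + 1), 32 / ((j : ℝ) + 1) ^ 2 ≤ K :=
      hsum.sum_le_tsum _ fun _ _ => by positivity
    set P := ∏ j ∈ Finset.range (n + 1), ((1 / 2 + a + j) ^ 2 + t ^ 2)
    set R := ∏ j ∈ Finset.range (n + 1), ((1 / 2 + j : ℝ) ^ 2 + t ^ 2)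
    have hP : 0 < P := Finset.prod_pos fun _ _ => by positivity
    have hR : 0 < R := Finset.prod_pos fun _ _ => by positivity
    set B : ℝ := (1 / 2 + (n + 1 : ℕ)) ^ 2 + t ^ 2
    have hB : 0 < B := by positivity
    have hp' : P * (Real.exp (-K) * (t ^ 2) ^ a) ≤ R * B ^ a := by
      calc P * (Real.exp (-K) * (t ^ 2) ^ a)
          ≤ R * (B / ((1 / 2 : ℝ) ^ 2 + t ^ 2)) ^ a * Real.exp K *
            (Real.exp (-K) * (t ^ 2) ^ a) := by
            gcongr
            exact hp.trans (by gcongr)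
        _ = R * ((B / ((1 / 2 : ℝ) ^ 2 + t ^ 2)) ^ a * (t ^ 2) ^ a) := by
            have : Real.exp K * Real.exp (-K) = 1 := by rw [← Real.exp_add]; simp
            linear_combination R * (B / ((1 / 2 : ℝ) ^ 2 + t ^ 2)) ^ a * (t ^ 2) ^ a * this
        _ ≤ R * B ^ a := by
            rw [← Real.mul_rpow (by positivity) (by positivity)]
            gcongr
            rw [div_mul_eq_mul_div, div_le_iff₀ (by positivity)]
            gcongr
            nlinarith
    have e1 : (n : ℝ) ^ (2 * (1 / 2 + a)) = (n : ℝ) ^ (2 * (1 / 2 : ℝ)) * ((n : ℝ) ^ 2) ^ a := by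
      rw [← Real.rpow_natCast, ← Real.rpow_mul hn'.le, ← Real.rpow_add hn']
      norm_num
      ring_nf
    rw [Real.div_rpow hB.le (by positivity), e1]
    set X : ℝ := (n : ℝ) ^ (2 * (1 / 2 : ℝ)) * (n.factorial : ℝ) ^ 2
    have hX : 0 ≤ X := by positivity
    have hna : 0 < ((n : ℝ) ^ 2) ^ a := by positivity
    have : (n : ℝ) ^ (2 * (1 / 2 : ℝ)) * ((n : ℝ) ^ 2) ^ a * (n.factorial : ℝ) ^ 2 / P *
        (B ^ a / ((n : ℝ) ^ 2) ^ a) = X * (B ^ a / P) := by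
      simp only [X]; field_simp
    rw [this, mul_div_assoc', mul_comm _ X, mul_div_assoc]
    refine mul_le_mul_of_nonneg_left ?_ hX
    rw [div_le_div_iff₀ hR hP]
    linarith
  have e2 : (t ^ 2) ^ a = (t ^ a) ^ 2 := by
    rw [← Real.rpow_natCast, ← Real.rpow_natCast, ← Real.rpow_mul ht0.le, ← Real.rpow_mul ht0.le,
      mul_comm]
  have e3 : Real.exp (-K) = Real.exp (-K / 2) ^ 2 := by
    rw [← Real.exp_nat_mul]; congr 1; push_cast; ring
  rw [e2, e3, ← mul_pow, ← mul_pow] at hsq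
  simpa using abs_le_of_sq_le_sq' hsq (norm_nonneg _) |>.2

/-- On this line `1 - s` is the conjugate of `s`, so the reflection formula gives `|Γ(s)|² = π /
cosh(πt)`. -/
lemma exp_le_norm_Gamma_half {t : ℝ} (ht : 0 ≤ t) :
    Real.exp (-(Real.pi * t / 2)) ≤ ‖Complex.Gamma (1 / 2 + t * Complex.I)‖ := by
  have h1 := Gamma_mul_Gamma_one_sub (1 / 2 + t * Complex.I)
  have h2 : (1 : ℂ) - (1 / 2 + t * Complex.I) = (starRingEnd ℂ) (1 / 2 + t * Complex.I) := by
    rw [show (1 / 2 : ℂ) = ((1 / 2 : ℝ) : ℂ) by push_cast; rfl, map_add, map_mul, Complex.conj_I,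
      conj_ofReal, conj_ofReal]
    push_cast
    ring
  have h3 : Complex.sin (Real.pi * (1 / 2 + t * Complex.I)) = Real.cosh (Real.pi * t) := by
    rw [mul_add, show (Real.pi : ℂ) * (1 / 2) = Real.pi / 2 by ring, add_comm,
      Complex.sin_add_pi_div_two, show (Real.pi : ℂ) * (t * Complex.I) = (Real.pi * t : ℝ) * Complex.I by
        push_cast; ring, Complex.cos_mul_I, ofReal_cosh]
  rw [h2, Gamma_conj, mul_conj, h3, normSq_eq_norm_sq] at h1
  have h4 : ‖Complex.Gamma (1 / 2 + t * Complex.I)‖ ^ 2 = Real.pi / Real.cosh (Real.pi * t) := by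
    exact_mod_cast h1
  refine abs_le_of_sq_le_sq' ?_ (norm_nonneg _) |>.2
  rw [h4, le_div_iff₀ (Real.cosh_pos _), ← Real.exp_nat_mul]
  have hpt : 0 ≤ Real.pi * t := by positivity
  have h5 : Real.cosh (Real.pi * t) ≤ Real.exp (Real.pi * t) := by
    rw [Real.cosh_eq]
    have := Real.exp_le_exp.2 (show -(Real.pi * t) ≤ Real.pi * t by linarith)
    linarith
  calc Real.exp ((2 : ℕ) * -(Real.pi * t / 2)) * Real.cosh (Real.pi * t)
      ≤ Real.exp ((2 : ℕ) * -(Real.pi * t / 2)) * Real.exp (Real.pi * t) := by gcongr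
    _ = 1 := by rw [← Real.exp_add]; push_cast; ring_nf; simp
    _ ≤ Real.pi := by linarith [Real.pi_gt_three]

/-- A lower bound of Stirling type for the Gamma function on vertical strips. -/
lemma exists_rpow_mul_exp_le_norm_Gamma : ∃ c : ℝ, 0 < c ∧ ∀ σ t : ℝ, 1 / 2 ≤ σ → 1 ≤ t →
    c * t ^ (σ - 1 / 2) * Real.exp (-(Real.pi * t / 2)) ≤ ‖Complex.Gamma (σ + t * Complex.I)‖ := by
  obtain ⟨c, hc, h⟩ := exists_mul_rpow_mul_norm_Gamma_le
  refine ⟨c, hc, fun σ t hσ ht => ?_⟩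
  have ht0 : 0 < t := by linarith
  -- Here `σ - 1/2 = a + m` with `m` the integer part. Each integer shift is `Γ(s + 1) = s Γ(s)`
  -- with `|s| ≥ t`, so the constant does not depend on `σ`.
  have key : ∀ (m : ℕ) (a : ℝ), 0 ≤ a → a ≤ 1 →
      c * t ^ (a + m) * Real.exp (-(Real.pi * t / 2)) ≤
        ‖Complex.Gamma ((1 / 2 + a + m : ℝ) + t * Complex.I)‖ := by
    intro m a ha0 ha1
    induction m with
    | zero =>
      have := (mul_le_mul_of_nonneg_left (exp_le_norm_Gamma_half ht0.le)
        (show 0 ≤ c * t ^ a by positivity)).trans (h a t ha0 ha1 ht)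
      simpa using this
    | succ m ih =>
      have hs : ((1 / 2 + a + (m + 1 : ℕ) : ℝ) + t * Complex.I : ℂ) =
          ((1 / 2 + a + m : ℝ) + t * Complex.I) + 1 := by push_cast; ring
      have him : (((1 / 2 + a + m : ℝ) : ℂ) + t * Complex.I).im = t := by simp
      have hne : (((1 / 2 + a + m : ℝ) : ℂ) + t * Complex.I) ≠ 0 := by
        intro h0
        rw [h0] at him
        simp at him
        linarith
      rw [hs, Gamma_add_one _ hne, norm_mul]
      have h1 : t ≤ ‖((1 / 2 + a + m : ℝ) : ℂ) + t * Complex.I‖ := by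
        have := abs_im_le_norm (((1 / 2 + a + m : ℝ) : ℂ) + t * Complex.I)
        rwa [him, abs_of_pos ht0] at this
      have h2 : t ^ (a + (m + 1 : ℕ)) = t * t ^ (a + m) := by
        rw [Nat.cast_add, ← add_assoc, Nat.cast_one, Real.rpow_add_one ht0.ne', mul_comm]
      rw [h2]
      calc c * (t * t ^ (a + m)) * Real.exp (-(Real.pi * t / 2))
          = t * (c * t ^ (a + m) * Real.exp (-(Real.pi * t / 2))) := by ring
        _ ≤ _ := by gcongr
  have hfl := Nat.floor_le (show 0 ≤ σ - 1 / 2 by linarith)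
  have hfl' := Nat.lt_floor_add_one (σ - 1 / 2)
  have := key ⌊σ - 1 / 2⌋₊ (σ - 1 / 2 - ⌊σ - 1 / 2⌋₊) (by linarith) (by linarith)
  convert this using 4 <;> ring_nf

end GammaLowerBound

/-! ### Mellin transforms along rotated rays -/

section RotatedMellin

open MeasureTheory ProbabilityTheory Complex

lemma ofReal_mul_cpow {x : ℝ} (hx : 0 < x) {z : ℂ} (hz : z ≠ 0) (s : ℂ) :
    ((x : ℂ) * z) ^ s = (x : ℂ) ^ s * z ^ s := by
  have hx' : (x : ℂ) ≠ 0 := by exact_mod_cast hx.ne'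
  rw [cpow_def_of_ne_zero (mul_ne_zero hx' hz), cpow_def_of_ne_zero hx', cpow_def_of_ne_zero hz,
    log_ofReal_mul hx hz, ← Complex.exp_add, ofReal_log hx.le]
  ring_nf

/-- Euler's integral along a rotated ray, for a real exponent. -/
lemma integral_cpow_mul_exp_neg_mul_Ioi_of_re_pos {σ : ℝ} (hσ : 0 < σ) {r : ℂ} (hr : 0 < r.re) :
    ∫ t : ℝ in Set.Ioi 0, (t : ℂ) ^ ((σ : ℂ) - 1) * Complex.exp (-(r * t)) =
      (1 / r) ^ (σ : ℂ) * Complex.Gamma σ := by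
  -- The integral is the complex moment generating function of `t^(σ-1) dt` at `-r`, hence analytic
  -- in `r`. Both sides agree for real `r`, and the identity theorem does the rest.
  set μ : Measure ℝ := (volume.restrict (Set.Ioi 0)).withDensity
    (fun t => ENNReal.ofReal (t ^ (σ - 1))) with hμ
  have hmeas : Measurable fun t : ℝ => ENNReal.ofReal (t ^ (σ - 1)) := by fun_prop
  have hlt : ∀ᵐ t ∂(volume.restrict (Set.Ioi (0 : ℝ))), ENNReal.ofReal (t ^ (σ - 1)) < ⊤ :=
    Eventually.of_forall fun _ => ENNReal.ofReal_lt_top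
  have hM (z : ℂ) : complexMGF id μ z =
      ∫ t : ℝ in Set.Ioi 0, (t : ℂ) ^ ((σ : ℂ) - 1) * Complex.exp (z * t) := by
    rw [complexMGF, hμ, integral_withDensity_eq_integral_toReal_smul hmeas hlt]
    refine setIntegral_congr_fun measurableSet_Ioi fun t (ht : 0 < t) => ?_
    simp only [id]
    rw [ENNReal.toReal_ofReal (by positivity), Complex.real_smul, ofReal_cpow ht.le]
    push_cast
    rfl
  have hsub : {z : ℂ | z.re < 0} ⊆ {z : ℂ | z.re ∈ interior (integrableExpSet id μ)} := by
    have : Set.Iio (0 : ℝ) ⊆ interior (integrableExpSet id μ) := by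
      refine interior_maximal (fun a (ha : a < 0) => ?_) isOpen_Iio
      change Integrable (fun t : ℝ => Real.exp (a * t)) μ
      rw [hμ, integrable_withDensity_iff_integrable_smul' hmeas hlt]
      have := Real.integral_rpow_mul_exp_neg_mul_Ioi hσ (neg_pos.2 ha)
      -- The integral of a non-integrable function is `0` by convention, so a nonzero value proves
      -- integrability.
      have hne : ∫ t : ℝ in Set.Ioi 0, t ^ (σ - 1) * Real.exp (-(-a * t)) ≠ 0 := by
        rw [this]
        have h1 := Real.Gamma_pos_of_pos hσ
        have h2 : 0 < 1 / -a := by have := neg_pos.2 ha; positivity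
        positivity
      have hi := not_imp_comm.1 integral_undef hne
      refine (integrableOn_congr_fun (fun t (ht : 0 < t) => ?_) measurableSet_Ioi).1 hi
      rw [ENNReal.toReal_ofReal (by positivity), smul_eq_mul]
      simp
    exact fun z hz => this hz
  have hopen : IsOpen {z : ℂ | z.re < 0} := isOpen_lt continuous_re continuous_const
  have hconv : Convex ℝ {z : ℂ | z.re < 0} := convex_halfSpace_re_lt 0
  have hA : AnalyticOnNhd ℂ (complexMGF id μ) {z : ℂ | z.re < 0} :=
    analyticOnNhd_complexMGF.mono hsub
  have hB : AnalyticOnNhd ℂ (fun z => (1 / -z) ^ (σ : ℂ) * Complex.Gamma σ) {z : ℂ | z.re < 0} := by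
    refine DifferentiableOn.analyticOnNhd (fun z (hz : z.re < 0) => ?_) hopen
    have hz0 : -z ≠ 0 := fun h => by
      have := congrArg Complex.re h
      simp at this
      linarith
    refine DifferentiableAt.differentiableWithinAt ?_
    refine DifferentiableAt.mul_const (DifferentiableAt.cpow_const ?_ ?_) _
    · exact (differentiableAt_const _).div differentiableAt_id.neg hz0
    · left
      rw [one_div, Complex.inv_re]
      have := Complex.normSq_pos.2 hz0
      have : 0 < (-z).re := by simpa using hz
      positivity
  have hfreq : ∃ᶠ z in nhdsWithin (-1 : ℂ) {(-1 : ℂ)}ᶜ,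
      complexMGF id μ z = (1 / -z) ^ (σ : ℂ) * Complex.Gamma σ := by
    have ht : Tendsto (fun x : ℝ => (x : ℂ)) (nhdsWithin (-1) (Set.Iio (-1)))
        (nhdsWithin (-1 : ℂ) {(-1 : ℂ)}ᶜ) := by
      refine tendsto_nhdsWithin_iff.2 ⟨?_, ?_⟩
      · have := (continuous_ofReal.tendsto (-1 : ℝ)).mono_left
          (nhdsWithin_le_nhds (s := Set.Iio (-1)))
        simpa using this
      · filter_upwards [self_mem_nhdsWithin] with x hx
        simp only [Set.mem_compl_iff, Set.mem_singleton_iff]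
        intro h
        have : x = -1 := by exact_mod_cast h
        exact absurd hx (by simp [this])
    refine ht.frequently (Eventually.frequently ?_)
    filter_upwards [self_mem_nhdsWithin] with x (hx : x < -1)
    have hx' : 0 < -x := by linarith
    have := Complex.integral_cpow_mul_exp_neg_mul_Ioi (a := (σ : ℂ)) (by simpa using hσ) hx'
    rw [hM, ← ofReal_neg, ← this]
    refine setIntegral_congr_fun measurableSet_Ioi fun t _ => ?_
    simp
  have := hA.eqOn_of_preconnected_of_frequently_eq hB hconv.isPreconnected
    (by simp : (-1 : ℂ) ∈ {z : ℂ | z.re < 0}) hfreq (show -r ∈ {z : ℂ | z.re < 0} by simpa using hr)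
  simp only [hM, neg_neg] at this
  simpa only [neg_mul] using this

/-- A Dirichlet series as the Mellin transform of an exponential series along a rotated ray. -/
lemma hasSum_mellin_of_re_pos {ι : Type*} [Countable ι] {a : ι → ℂ} {p : ι → ℝ} {w : ℂ}
    {G : ℝ → ℂ} {σ : ℝ} (hp : ∀ i, a i = 0 ∨ 0 < p i) (hw : 0 < w.re) (hσ : 0 < σ)
    (hG : ∀ t ∈ Set.Ioi (0 : ℝ), HasSum (fun i => a i * Complex.exp (-(p i * w * t))) (G t))
    (hsum : Summable fun i => ‖a i‖ / (p i) ^ σ) :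
    HasSum (fun i => a i * ((1 / (p i * w)) ^ (σ : ℂ) * Complex.Gamma σ)) (mellin G σ) := by
  have hre {i} (hi : 0 < p i) : 0 < ((p i : ℂ) * w).re := by simpa using mul_pos hi hw
  have hint {i} (hi : 0 < p i) : IntegrableOn (fun t : ℝ => t ^ (σ - 1) *
      Real.exp (-(p i * w.re * t))) (Set.Ioi 0) := by
    have hpw : 0 < p i * w.re := mul_pos hi hw
    refine not_imp_comm.1 integral_undef ?_
    rw [Real.integral_rpow_mul_exp_neg_mul_Ioi hσ hpw]
    have h1 := Real.Gamma_pos_of_pos hσ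
    positivity
  -- In absolute value the rotation only replaces `w` by `Re w`, so the interchange of sum and
  -- integral needs no more than absolute convergence at `σ`.
  have hnorm (i : ι) {t : ℝ} (ht : 0 < t) :
      ‖(t : ℂ) ^ ((σ : ℂ) - 1) * (a i * Complex.exp (-(p i * w * t)))‖ =
        ‖a i‖ * (t ^ (σ - 1) * Real.exp (-(p i * w.re * t))) := by
    rw [norm_mul, norm_mul, norm_cpow_eq_rpow_re_of_pos ht, Complex.norm_exp]
    simp
    ring
  rw [mellin]
  simp_rw [smul_eq_mul, ← setIntegral_congr_fun measurableSet_Ioi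
    (fun t ht => congr_arg _ (hG t ht).tsum_eq), ← tsum_mul_left]
  have hF (i : ι) : Integrable (fun t : ℝ => (t : ℂ) ^ ((σ : ℂ) - 1) *
      (a i * Complex.exp (-(p i * w * t)))) (volume.restrict (Set.Ioi 0)) := by
    rcases hp i with h | h
    · simp [h]
    refine ((hint h).const_mul ‖a i‖).mono' ?_ ?_
    · refine ContinuousOn.aestronglyMeasurable (fun t (ht : 0 < t) => ?_) measurableSet_Ioi
      refine ContinuousAt.continuousWithinAt ?_
      refine ContinuousAt.mul ?_ (by fun_prop)
      exact continuousAt_ofReal_cpow_const _ _ (Or.inr ht.ne')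
    · exact (ae_restrict_mem measurableSet_Ioi).mono fun t ht => (hnorm i ht).le
  convert! hasSum_integral_of_summable_integral_norm hF ?_ using 2 with i
  · rcases hp i with h | h
    · simp [h]
    rw [← integral_cpow_mul_exp_neg_mul_Ioi_of_re_pos hσ (hre h), ← integral_const_mul]
    congr 1
    ext t
    ring
  · have : ∀ i, ∫ t in Set.Ioi (0 : ℝ), ‖(t : ℂ) ^ ((σ : ℂ) - 1) *
        (a i * Complex.exp (-(p i * w * t)))‖ =
        (‖a i‖ / p i ^ σ) * ((1 / w.re) ^ σ * Real.Gamma σ) := by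
      intro i
      rw [setIntegral_congr_fun measurableSet_Ioi (fun t ht => hnorm i ht), integral_const_mul]
      rcases hp i with h | h
      · simp [h]
      rw [Real.integral_rpow_mul_exp_neg_mul_Ioi hσ (mul_pos h hw), one_div, one_div, mul_inv,
        Real.mul_rpow (by positivity) (by positivity), Real.inv_rpow h.le]
      ring
    simp_rw [this]
    exact hsum.mul_right _

end RotatedMellin

/-! ### Cusp forms on rays through the origin -/

namespace FrickeZeros

open Complex

variable {N : ℕ} [NeZero N] {k : ℤ}

/-- The function `w ↦ g(iw/Q)` on the right half plane. -/
noncomputable def ray (g : ℍ → ℂ) (Q : ℝ) (w : ℂ) : ℂ := g (ofComplex (Complex.I * w / Q))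

lemma im_I_mul_div {Q : ℝ} (w : ℂ) : (Complex.I * w / Q).im = w.re / Q := by
  rw [Complex.div_ofReal_im]
  simp

lemma coe_ofComplex_I_mul_div {Q : ℝ} (hQ : 0 < Q) {w : ℂ} (hw : 0 < w.re) :
    ((ofComplex (Complex.I * w / Q) : ℍ) : ℂ) = Complex.I * w / Q := by
  rw [ofComplex_apply_of_im_pos (by rw [im_I_mul_div]; positivity)]

omit [NeZero N] in
lemma continuousOn_ray (g : Cusp N k) {Q : ℝ} (hQ : 0 < Q) :
    ContinuousOn (ray g Q) {w : ℂ | 0 < w.re} := by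
  have h1 : ContinuousOn (fun w : ℂ => Complex.I * w / Q) {w : ℂ | 0 < w.re} := by fun_prop
  have h2 : ContinuousOn ((g : ℍ → ℂ) ∘ ofComplex) {z : ℂ | 0 < z.im} :=
    (UpperHalfPlane.mdifferentiable_iff.1 g.holo').continuousOn
  refine h2.comp h1 fun w hw => ?_
  change 0 < (Complex.I * w / Q).im
  rw [im_I_mul_div]
  exact div_pos hw hQ

lemma hasSum_ray (g : Cusp N k) {Q : ℝ} (hQ : 0 < Q) {w : ℂ} (hw : 0 < w.re) :
    HasSum (fun n : ℕ => coeff g n * Complex.exp (-((2 * Real.pi * n / Q : ℝ) * w)))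
      (ray g Q w) := by
  have h := ModularForm.hasSum_qExpansion (h := 1) g one_pos (by simp)
    (ofComplex (Complex.I * w / Q))
  rw [ray]
  convert! h using 2 with n
  rw [coeff]
  congr 1
  rw [Function.Periodic.qParam, ← Complex.exp_nat_mul, coe_ofComplex_I_mul_div hQ hw]
  congr 1
  push_cast
  linear_combination (-(2 * Real.pi * n * w / Q)) * Complex.I_mul_I

/-- A cusp form is `O(y^{-k/2} e^{-cy})`. -/
lemma exists_norm_ray_le (g : Cusp N k) {Q : ℝ} (hQ : 0 < Q) :
    ∃ C c : ℝ, 0 < C ∧ 0 < c ∧ ∀ w : ℂ, 0 < w.re →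
      ‖ray g Q w‖ ≤ C * w.re ^ (-((k : ℝ) / 2)) * Real.exp (-c * w.re) := by
  obtain ⟨C₁, hC₁⟩ := CuspFormClass.exists_bound g
  have h2 := CuspFormClass.exp_decay_atImInfty (h := 1) g one_pos (by simp)
  obtain ⟨D, hD⟩ := h2.bound
  obtain ⟨B, hB⟩ := (atImInfty_mem _).1 hD
  have h3 := (isLittleO_rpow_exp_pos_mul_atTop ((k : ℝ) / 2) (b := 1) one_pos).bound one_pos
  obtain ⟨B', hB'⟩ := eventually_atTop.1 h3
  -- Above height `B₂` the decay `e^{-2πy}` leaves room to absorb `y^(k/2)`. Below it, Hecke's bound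
  -- `y^(-k/2)` suffices and inserting `e^{-y}` costs at most `e^{B₂}`.
  set B₂ := max (max B B') 0
  have key (z : ℍ) : ‖g z‖ ≤ (max (C₁ * Real.exp B₂) D + 1) *
      z.im ^ (-((k : ℝ) / 2)) * Real.exp (-1 * z.im) := by
    have hz := z.im_pos
    have hp : 0 < z.im ^ (-((k : ℝ) / 2)) := by positivity
    have hpp : z.im ^ ((k : ℝ) / 2) * z.im ^ (-((k : ℝ) / 2)) = 1 := by
      rw [← Real.rpow_add hz]; simp
    have hmono : ∀ X, X ≤ max (C₁ * Real.exp B₂) D → X * z.im ^ (-((k : ℝ) / 2)) *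
        Real.exp (-1 * z.im) ≤ (max (C₁ * Real.exp B₂) D + 1) *
          z.im ^ (-((k : ℝ) / 2)) * Real.exp (-1 * z.im) := by
      intro X hX
      gcongr
      linarith
    rcases le_total B₂ z.im with h | h
    · have hb := hB z (((le_max_left _ _).trans (le_max_left _ _)).trans h)
      simp only [Set.mem_ofPred_eq] at hb
      have hb' := hB' z.im (((le_max_right _ _).trans (le_max_left _ _)).trans h)
      rw [Real.norm_of_nonneg (Real.exp_pos _).le] at hb
      rw [Real.norm_of_nonneg (by positivity), Real.norm_of_nonneg (Real.exp_pos _).le, one_mul,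
        one_mul] at hb'
      have hD0 : 0 ≤ D := by
        by_contra hneg
        have : D * Real.exp (-2 * Real.pi * z.im / 1) < 0 :=
          mul_neg_of_neg_of_pos (by linarith) (Real.exp_pos _)
        linarith [norm_nonneg (g z)]
      refine hb.trans (le_trans ?_ (hmono D (le_max_right _ _)))
      rw [mul_assoc D]
      refine mul_le_mul_of_nonneg_left ?_ hD0
      have e1 : 1 ≤ Real.exp z.im * z.im ^ (-((k : ℝ) / 2)) := by
        rw [← hpp]; gcongr
      calc Real.exp (-2 * Real.pi * z.im / 1) ≤ Real.exp (-2 * z.im) * 1 := by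
            rw [mul_one]
            apply Real.exp_le_exp.2
            have := Real.pi_gt_three
            nlinarith
        _ ≤ Real.exp (-2 * z.im) * (Real.exp z.im * z.im ^ (-((k : ℝ) / 2))) := by gcongr
        _ = z.im ^ (-((k : ℝ) / 2)) * (Real.exp (-2 * z.im) * Real.exp z.im) := by ring
        _ = _ := by rw [← Real.exp_add]; ring_nf
    · have hb := hC₁ z
      have hC0 : 0 ≤ C₁ := by
        by_contra hneg
        have : C₁ / z.im ^ ((k : ℝ) / 2) < 0 := div_neg_of_neg_of_pos (by linarith) (by positivity)
        linarith [norm_nonneg (g z)]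
      refine hb.trans (le_trans ?_ (hmono _ (le_max_left _ _)))
      rw [div_eq_mul_inv, ← Real.rpow_neg hz.le]
      calc C₁ * z.im ^ (-((k : ℝ) / 2)) = C₁ * z.im ^ (-((k : ℝ) / 2)) * 1 := by ring
        _ ≤ C₁ * z.im ^ (-((k : ℝ) / 2)) * Real.exp (B₂ - z.im) := by
            gcongr; exact Real.one_le_exp (by linarith)
        _ = _ := by
            rw [show B₂ - z.im = B₂ + -1 * z.im by ring, Real.exp_add]; ring
  set M := max (C₁ * Real.exp B₂) D + 1
  refine ⟨(|M| + 1) * (Q⁻¹) ^ (-((k : ℝ) / 2)), Q⁻¹, by positivity, by positivity,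
    fun w hw => ?_⟩
  have h := key (ofComplex (Complex.I * w / Q))
  have him : (ofComplex (Complex.I * w / Q) : ℍ).im = w.re * Q⁻¹ := by
    rw [← coe_im, coe_ofComplex_I_mul_div hQ hw, im_I_mul_div, div_eq_mul_inv]
  rw [him, Real.mul_rpow hw.le (by positivity)] at h
  refine h.trans ?_
  calc M * (w.re ^ (-((k : ℝ) / 2)) * Q⁻¹ ^ (-((k : ℝ) / 2))) * Real.exp (-1 * (w.re * Q⁻¹))
      ≤ (|M| + 1) * (w.re ^ (-((k : ℝ) / 2)) * Q⁻¹ ^ (-((k : ℝ) / 2))) *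
        Real.exp (-1 * (w.re * Q⁻¹)) := by
        gcongr
        linarith [le_abs_self M]
    _ = _ := by
        rw [show -1 * (w.re * Q⁻¹) = -Q⁻¹ * w.re by ring]; ring

/-- In the coordinate `z = iw/√N` the map `z ↦ -1/(Nz)` becomes `w ↦ w⁻¹`, and the factor `i^k
N^(-k/2) z^(-k)` becomes `w^(-k)`. -/
lemma ray_fricke (f : Cusp N k) {w : ℂ} (hw : 0 < w.re) :
    ray (fricke f) (Real.sqrt N) w = w ^ (-k) * ray f (Real.sqrt N) w⁻¹ := by
  have hN : (0 : ℝ) < N := Nat.cast_pos.mpr (Nat.pos_of_ne_zero (NeZero.ne N))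
  have hQ : 0 < Real.sqrt N := Real.sqrt_pos.2 hN
  have hw0 : w ≠ 0 := fun h => by simp [h] at hw
  have hwi : 0 < (w⁻¹).re := by
    rw [Complex.inv_re]
    have := Complex.normSq_pos.2 hw0
    positivity
  have hQc : ((Real.sqrt N : ℝ) : ℂ) ≠ 0 := by exact_mod_cast hQ.ne'
  have hQQ : ((Real.sqrt N : ℝ) : ℂ) * ((Real.sqrt N : ℝ) : ℂ) = N := by
    rw [← ofReal_mul, Real.mul_self_sqrt hN.le, ofReal_natCast]
  change frickeFun N k f (ofComplex (Complex.I * w / (Real.sqrt N : ℝ))) = _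
  have hpt : frickePoint N (ofComplex (Complex.I * w / (Real.sqrt N : ℝ))) =
      ofComplex (Complex.I * w⁻¹ / (Real.sqrt N : ℝ)) := by
    ext
    rw [coe_ofComplex_I_mul_div hQ hwi]
    change -1 / ((N : ℂ) * (ofComplex (Complex.I * w / (Real.sqrt N : ℝ)) : ℍ)) = _
    rw [coe_ofComplex_I_mul_div hQ hw, ← hQQ]
    have := Complex.I_ne_zero
    field_simp
    rw [Complex.I_sq]
  rw [frickeFun, hpt, coe_ofComplex_I_mul_div hQ hw, ray]
  congr 1
  have hpow : (((N : ℝ) ^ (-(k : ℝ) / 2) : ℝ) : ℂ) = ((Real.sqrt N : ℝ) : ℂ) ^ (-k) := by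
    rw [Real.sqrt_eq_rpow, ← ofReal_zpow, ← Real.rpow_intCast, ← Real.rpow_mul hN.le]
    congr 2
    push_cast
    ring
  have h1 : Complex.I ^ k * Complex.I ^ (-k) = 1 := by
    rw [← zpow_add₀ Complex.I_ne_zero]; simp
  have h2 : ((Real.sqrt N : ℝ) : ℂ) ^ (-k) * (((Real.sqrt N : ℝ) : ℂ) ^ (-k))⁻¹ = 1 :=
    mul_inv_cancel₀ (zpow_ne_zero _ hQc)
  rw [hpow, div_zpow, mul_zpow, div_eq_mul_inv]
  linear_combination (w ^ (-k)) * h1 * (((Real.sqrt N : ℝ) : ℂ) ^ (-k) *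
    (((Real.sqrt N : ℝ) : ℂ) ^ (-k))⁻¹) + w ^ (-k) * h2

omit [NeZero N] in
lemma ray_add_smul (f g : Cusp N k) (ε : ℂ) (Q : ℝ) (w : ℂ) :
    ray (f + ε • g : Cusp N k) Q w = ray f Q w + ε * ray g Q w := by
  simp [ray]

/-- Real `σ` in the half-plane of absolute convergence is enough; analytic continuation in `s`
follows in `mellin_eq_of_re_pos`. -/
lemma mellin_ray (hk : 0 < k) (g : Cusp N k) {Q : ℝ} (hQ : 0 < Q) {w : ℂ} (hw : 0 < w.re)
    {σ : ℝ} (hσ : (k : ℝ) / 2 + 1 < σ) :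
    mellin (fun y : ℝ => ray g Q (w * y)) σ =
      (1 / w) ^ (σ : ℂ) * ((Q / (2 * Real.pi) : ℝ) : ℂ) ^ (σ : ℂ) * Complex.Gamma σ *
        LFun hk g σ := by
  have hk' : (0 : ℝ) < k := by exact_mod_cast hk
  have hσ0 : 0 < σ := by linarith
  obtain ⟨hs, hL⟩ := LFun_eq_LSeries hk g (s := (σ : ℂ)) (by simpa using hσ)
  have h0 : coeff g 0 = 0 := CuspFormClass.qExpansion_coeff_zero g one_pos (by simp)
  have hp (n : ℕ) : coeff g n = 0 ∨ 0 < 2 * Real.pi * n / Q := by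
    rcases Nat.eq_zero_or_pos n with rfl | hn
    · exact Or.inl h0
    · have : (0 : ℝ) < n := by exact_mod_cast hn
      right
      positivity
  have hsum : Summable fun n : ℕ => ‖coeff g n‖ / (2 * Real.pi * n / Q) ^ σ := by
    have := (hs.norm).mul_left ((2 * Real.pi / Q) ^ σ)⁻¹
    refine this.congr fun n => ?_
    rcases Nat.eq_zero_or_pos n with rfl | hn
    · simp [h0]
    have hn' : (0 : ℝ) < n := by exact_mod_cast hn
    rw [LSeries.term_of_ne_zero hn.ne', norm_div, ← ofReal_natCast,
      norm_cpow_eq_rpow_re_of_pos hn', ofReal_re,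
      show 2 * Real.pi * n / Q = 2 * Real.pi / Q * n by ring,
      Real.mul_rpow (by positivity) (by positivity)]
    field_simp
  have h := hasSum_mellin_of_re_pos (G := fun y : ℝ => ray g Q (w * y)) hp hw hσ0
    (fun t (ht : 0 < t) => by
      have := hasSum_ray g hQ (w := w * t) (by simpa using mul_pos hw ht)
      simpa only [mul_assoc] using this) hsum
  rw [hL, LSeries, ← tsum_mul_left, ← h.tsum_eq]
  refine tsum_congr fun n => ?_
  rcases Nat.eq_zero_or_pos n with rfl | hn
  · simp [h0]
  have hn' : (0 : ℝ) < n := by exact_mod_cast hn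
  rw [LSeries.term_of_ne_zero hn.ne']
  have e : (1 / (((2 * Real.pi * n / Q : ℝ) : ℂ) * w)) =
      ((Q / (2 * Real.pi) : ℝ) : ℂ) * (((n : ℝ)⁻¹ : ℝ) : ℂ) * (1 / w) := by
    push_cast
    have : (n : ℂ) ≠ 0 := by exact_mod_cast hn'.ne'
    have : (Q : ℂ) ≠ 0 := by exact_mod_cast hQ.ne'
    have : w ≠ 0 := fun h => by simp [h] at hw
    have : (Real.pi : ℂ) ≠ 0 := by exact_mod_cast Real.pi_ne_zero
    field_simp
  rw [e, ← ofReal_mul, ofReal_mul_cpow (by positivity) (one_div_ne_zero fun h => by simp [h] at hw), ofReal_mul,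
    mul_cpow_ofReal_nonneg (by positivity) (by positivity), ofReal_inv, ofReal_natCast,
    Complex.inv_cpow _ _ (by rw [natCast_arg]; exact Real.pi_ne_zero.symm)]
  ring

end FrickeZeros

/-! ### Dirichlet series far to the right -/

section DirichletSeries

open Complex Topology

/-- Far to the right a Dirichlet series is close to its first term. -/
lemma exists_norm_natCast_cpow_mul_LSeries_sub_le {a : ℕ → ℂ} {σ₀ : ℝ}
    (hs : ∀ s : ℂ, σ₀ < s.re → LSeriesSummable a s) {n₀ : ℕ} (hn₀ : n₀ ≠ 0) (ha : a n₀ ≠ 0)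
    (hmin : ∀ m < n₀, a m = 0) (B : ℝ) :
    ∃ σ₁ : ℝ, B < σ₁ ∧ ∀ s : ℂ, s.re = σ₁ → ‖(n₀ : ℂ) ^ s * LSeries a s - a n₀‖ ≤ ‖a n₀‖ / 2 := by
  classical
  have hn₀' : (0 : ℝ) < n₀ := by exact_mod_cast Nat.pos_of_ne_zero hn₀
  -- The tail after `n₀` is majorised, uniformly in `Im s`, by the series with coefficients `‖a n‖`.
  -- Its sum at `x` is `O((n₀ + 1)^(-x))`, which multiplication by `n₀^x` does not prevent from
  -- tending to `0`.
  set b : ℕ → ℂ := fun n => if n ≤ n₀ then 0 else (‖a n‖ : ℂ) with hb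
  have hbs (x : ℝ) (hx : σ₀ < x) : LSeriesSummable b x := by
    refine Summable.of_norm_bounded (hs x (by simpa using hx)).norm fun n => ?_
    simp only [hb, LSeries.norm_term_eq]
    split_ifs
    · simp
    · simp
      positivity
    · simp
  have habs : LSeries.abscissaOfAbsConv b < ⊤ :=
    (LSeriesSummable.abscissaOfAbsConv_le (hbs (σ₀ + 1) (by linarith))).trans_lt
      (EReal.coe_lt_top _)
  have ht := LSeries.tendsto_cpow_mul_atTop (f := b) (n := n₀)
    (fun m hm => by simp [hb, hm]) habs
  have ht2 : Tendsto (fun x : ℝ => ((n₀ : ℝ) / (n₀ + 1)) ^ x) atTop (𝓝 0) :=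
    tendsto_rpow_atTop_of_base_lt_one _ (by
      have : 0 < (n₀ : ℝ) / (n₀ + 1) := by positivity
      linarith) (by rw [div_lt_one (by positivity)]; linarith)
  have ht3 := ht2.mul ht.norm
  rw [zero_mul] at ht3
  have hpos : 0 < ‖a n₀‖ / 2 := by positivity
  obtain ⟨x, hx⟩ := ((ht3.eventually (gt_mem_nhds hpos)).and
    ((eventually_gt_atTop B).and (eventually_gt_atTop σ₀))).exists
  obtain ⟨hx1, hxB, hx0⟩ := hx
  refine ⟨x, hxB, fun s hsx => ?_⟩
  have hS := hs s (by rw [hsx]; exact hx0)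
  have hsplit := hS.hasSum.sub (hasSum_ite_eq n₀ (LSeries.term a s n₀))
  have e1 : (n₀ : ℂ) ^ s * LSeries.term a s n₀ = a n₀ := by
    rw [LSeries.term_of_ne_zero hn₀]
    have : (n₀ : ℂ) ^ s ≠ 0 := by
      rw [Ne, Complex.cpow_eq_zero_iff]
      exact fun h => hn₀ (by exact_mod_cast h.1)
    field_simp
  have hnb (n : ℕ) : ‖LSeries.term a s n - (if n = n₀ then LSeries.term a s n₀ else 0)‖ =
      ‖LSeries.term b x n‖ := by
    rcases lt_trichotomy n n₀ with h | rfl | h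
    · rw [if_neg h.ne, sub_zero, LSeries.norm_term_eq, LSeries.norm_term_eq, hmin n h]
      simp [hb, h.le]
    · rw [if_pos rfl, sub_self, LSeries.norm_term_eq]
      simp [hb]
    · rw [if_neg h.ne', sub_zero, LSeries.norm_term_eq, LSeries.norm_term_eq]
      simp [hb, h.not_ge, hsx]
  have e3 : ‖LSeries b x‖ = ∑' n, ‖LSeries.term b x n‖ := by
    have : ∀ n, LSeries.term b x n = ((‖LSeries.term b x n‖ : ℝ) : ℂ) := by
      intro n
      rcases Nat.eq_zero_or_pos n with rfl | hn
      · simp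
      have hn' : (0 : ℝ) < n := by exact_mod_cast hn
      rw [LSeries.norm_term_eq, if_neg hn.ne', LSeries.term_of_ne_zero hn.ne', ofReal_div,
        ofReal_re, ofReal_cpow hn'.le, ofReal_natCast]
      congr 1
      simp only [hb]
      split_ifs <;> simp
    rw [LSeries, tsum_congr this, ← ofReal_tsum, Complex.norm_real, Real.norm_of_nonneg]
    exact tsum_nonneg fun _ => norm_nonneg _
  have e4 : ‖LSeries a s - LSeries.term a s n₀‖ ≤ ‖LSeries b x‖ := by
    change ‖(∑' n, LSeries.term a s n) - LSeries.term a s n₀‖ ≤ _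
    rw [← hsplit.tsum_eq, e3]
    refine (norm_tsum_le_tsum_norm ?_).trans (le_of_eq (tsum_congr hnb))
    exact (hbs x hx0).norm.congr fun n => (hnb n).symm
  have e5 : (n₀ : ℂ) ^ s * LSeries a s - a n₀ =
      (n₀ : ℂ) ^ s * (LSeries a s - LSeries.term a s n₀) := by rw [mul_sub, e1]
  rw [e5, norm_mul, ← ofReal_natCast, norm_cpow_eq_rpow_re_of_pos hn₀', hsx]
  refine le_trans ?_ hx1.le
  rw [norm_mul, show ((n₀ : ℂ) + 1) = (((n₀ : ℝ) + 1 : ℝ) : ℂ) by push_cast; rfl,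
    norm_cpow_eq_rpow_re_of_pos (by positivity), ofReal_re, ← mul_assoc,
    ← Real.mul_rpow (by positivity) (by positivity), div_mul_cancel₀ _ (by positivity)]
  gcongr

end DirichletSeries

/-! ### The analytic data attached to `f + ε f|W_N` -/

namespace FrickeZeros

open Complex Topology

/-- A function `F` on the right half plane, decaying at infinity and with a functional equation
under `w ↦ w⁻¹`, whose Mellin transforms along rays are given by a Dirichlet series `L`. -/
structure IsRotatedMellin (F L : ℂ → ℂ) (κ A : ℝ) : Prop where
  one_le : 1 ≤ κ
  pos : 0 < A
  continuousOn : ContinuousOn F {w | 0 < w.re}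
  bound : ∃ C c : ℝ, 0 < C ∧ 0 < c ∧ ∀ w : ℂ, 0 < w.re →
    ‖F w‖ ≤ C * w.re ^ (-(κ / 2)) * Real.exp (-c * w.re)
  norm_inv : ∀ w : ℂ, 0 < w.re → ‖F w⁻¹‖ = ‖w‖ ^ κ * ‖F w‖
  inv_real : ∃ ε : ℂ, (ε = 1 ∨ ε = -1) ∧ ∀ y : ℝ, 0 < y → F (y : ℂ)⁻¹ = ε * (y : ℂ) ^ (κ : ℂ) * F y
  conj_real : ∃ c : ℂ, c ≠ 0 ∧ ∀ y : ℝ, 0 < y → (starRingEnd ℂ) (c * F y) = c * F y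
  differentiable : Differentiable ℂ L
  mellin_eq : ∃ σ₀ : ℝ, ∀ w : ℂ, 0 < w.re → ∀ σ : ℝ, σ₀ < σ →
    mellin (fun y : ℝ => F (w * y)) σ =
      (1 / w) ^ (σ : ℂ) * (A : ℂ) ^ (σ : ℂ) * Complex.Gamma σ * L σ
  first_term : ∃ (σ₁ : ℝ) (n₀ : ℕ) (a : ℂ), κ / 2 < σ₁ ∧ n₀ ≠ 0 ∧ a ≠ 0 ∧
    ∀ s : ℂ, s.re = σ₁ → ‖(n₀ : ℂ) ^ s * L s - a‖ ≤ ‖a‖ / 2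

variable {N : ℕ} [NeZero N] {k : ℤ}

omit [NeZero N] in
lemma coeff_zero (f : Cusp N k) : coeff f 0 = 0 :=
  CuspFormClass.qExpansion_coeff_zero f one_pos (by simp)

omit [NeZero N] in
lemma coeff_add_smul (f g : Cusp N k) (ε : ℂ) :
    coeff (f + ε • g) = coeff f + ε • coeff g := by
  funext n
  have h1 := ModularForm.qExpansion_add (h := 1) one_pos (by simp) f (ε • g)
  have h2 := ModularForm.qExpansion_smul (h := 1) one_pos (by simp) ε g
  rw [coeff, FunLike.coe_add, h1, FunLike.coe_smul, h2]
  simp [coeff]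

lemma LFun_add_smul (hk : 0 < k) (f g : Cusp N k) (ε : ℂ) :
    LFun hk (f + ε • g) = fun s => LFun hk f s + ε * LFun hk g s := by
  have hd1 := differentiable_LFun hk (f + ε • g)
  have hd2 : Differentiable ℂ (fun s => LFun hk f s + ε * LFun hk g s) :=
    (differentiable_LFun hk f).add ((differentiable_LFun hk g).const_mul ε)
  refine AnalyticOnNhd.eq_of_eventuallyEq (z₀ := ((k : ℝ) / 2 + 2 : ℝ))
    (fun z _ => hd1.analyticAt z) (fun z _ => hd2.analyticAt z) ?_
  have hopen : IsOpen {s : ℂ | (k : ℝ) / 2 + 1 < s.re} := isOpen_lt continuous_const continuous_re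
  filter_upwards [hopen.mem_nhds (show (((k : ℝ) / 2 + 2 : ℝ) : ℂ) ∈ _ by
    simp only [Set.mem_ofPred_eq, ofReal_re]; linarith)] with s hs
  obtain ⟨h1, e1⟩ := LFun_eq_LSeries hk f hs
  obtain ⟨h2, e2⟩ := LFun_eq_LSeries hk g hs
  obtain ⟨-, e3⟩ := LFun_eq_LSeries hk (f + ε • g) hs
  rw [e1, e2, e3, coeff_add_smul, LSeries_add h1 (h2.smul ε), LSeries_smul]

lemma exists_coeff_ne_zero (hk : 0 < k) (g : Cusp N k) {s : ℂ} (hs : LFun hk g s ≠ 0) :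
    ∃ n, coeff g n ≠ 0 := by
  by_contra! h
  refine hs ?_
  have hd1 := differentiable_LFun hk g
  have : LFun hk g = fun _ => 0 := by
    refine AnalyticOnNhd.eq_of_eventuallyEq (z₀ := ((k : ℝ) / 2 + 2 : ℝ))
      (fun z _ => hd1.analyticAt z) (fun z _ => analyticAt_const) ?_
    have hopen : IsOpen {s : ℂ | (k : ℝ) / 2 + 1 < s.re} :=
      isOpen_lt continuous_const continuous_re
    filter_upwards [hopen.mem_nhds (show (((k : ℝ) / 2 + 2 : ℝ) : ℂ) ∈ _ by
      simp only [Set.mem_ofPred_eq, ofReal_re]; linarith)] with z hz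
    rw [(LFun_eq_LSeries hk g hz).2, show coeff g = 0 from funext h, LSeries_zero]
    rfl
  rw [this]

/-- On the imaginary axis all exponentials in the Fourier expansion are real. -/
lemma conj_ray_eq {f : Cusp N k} {c : ℂ} {Q : ℝ} (hQ : 0 < Q)
    (hc : ∀ n, (starRingEnd ℂ) (c * coeff f n) = c * coeff f n) {y : ℝ} (hy : 0 < y) :
    (starRingEnd ℂ) (c * ray f Q y) = c * ray f Q y := by
  have h := (hasSum_ray f hQ (w := y) (by simpa using hy)).mul_left c
  have h' := (Complex.hasSum_conj'.2 h)
  refine h'.unique ?_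
  convert! h using 2 with n
  rw [← mul_assoc, map_mul, hc, ← Complex.exp_conj, map_neg, map_mul, conj_ofReal, conj_ofReal]

/-- The combination `f + ε f|W_N` gives rise to a rotated Mellin transform. -/
lemma isRotatedMellin (hk : 0 < k) (f : Cusp N k)
    (hf : (∀ n : ℕ, (coeff f n).im = 0) ∨ (∀ n : ℕ, (coeff f n).re = 0))
    {ε : ℂ} (hε : ε = 1 ∨ ε = -1) (hne : ∃ s : ℂ, LFun hk f s + ε * LFun hk (fricke f) s ≠ 0) :
    IsRotatedMellin (ray (f + ε • fricke f : Cusp N k) (Real.sqrt N))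
      (fun s => LFun hk f s + ε * LFun hk (fricke f) s) k (Real.sqrt N / (2 * Real.pi)) := by
  have hN : (0 : ℝ) < N := Nat.cast_pos.mpr (Nat.pos_of_ne_zero (NeZero.ne N))
  have hQ : 0 < Real.sqrt N := Real.sqrt_pos.2 hN
  set g : Cusp N k := f + ε • fricke f with hg
  have hL : (fun s => LFun hk f s + ε * LFun hk (fricke f) s) = LFun hk g :=
    (LFun_add_smul hk f (fricke f) ε).symm
  have hεε : ε * ε = 1 := by rcases hε with rfl | rfl <;> norm_num
  have hinv {w : ℂ} (hw : 0 < w.re) : 0 < (w⁻¹).re := by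
    have hw0 : w ≠ 0 := fun h => by simp [h] at hw
    rw [Complex.inv_re]
    have := Complex.normSq_pos.2 hw0
    positivity
  -- `W_N` interchanges the two summands, so `ε² = 1` makes `g` an eigenfunction with eigenvalue
  -- `ε`.
  have hfe {w : ℂ} (hw : 0 < w.re) :
      ray g (Real.sqrt N) w⁻¹ = ε * w ^ k * ray g (Real.sqrt N) w := by
    have hw0 : w ≠ 0 := fun h => by simp [h] at hw
    have hwk : w ^ k * w ^ (-k) = 1 := by rw [← zpow_add₀ hw0]; simp
    rw [hg, ray_add_smul, ray_add_smul, ray_fricke f hw, ray_fricke f (hinv hw), inv_inv,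
      inv_zpow', neg_neg]
    linear_combination (-ray f (Real.sqrt N) w⁻¹) * hεε * (w ^ k * w ^ (-k)) +
      (-ray f (Real.sqrt N) w⁻¹) * hwk
  replace hne : ∃ s, LFun hk g s ≠ 0 := by rwa [← hL]
  rw [hL]
  refine ⟨by exact_mod_cast hk, by positivity, continuousOn_ray g hQ, exists_norm_ray_le g hQ,
    fun w hw => ?_, ⟨ε, hε, fun y hy => ?_⟩, ?_, differentiable_LFun hk g,
    ⟨(k : ℝ) / 2 + 1, fun w hw σ hσ => mellin_ray hk g hQ hw hσ⟩, ?_⟩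
  · have hε1 : ‖ε‖ = 1 := by rcases hε with rfl | rfl <;> simp
    rw [hfe hw, norm_mul, norm_mul, hε1, one_mul, norm_zpow, Real.rpow_intCast]
  · rw [hfe (by simpa using hy)]
    push_cast
    rw [cpow_intCast]
  · obtain ⟨c, hc0, hc⟩ : ∃ c : ℂ, c ≠ 0 ∧
        ∀ n, (starRingEnd ℂ) (c * coeff f n) = c * coeff f n := by
      rcases hf with h | h
      · exact ⟨1, one_ne_zero, fun n => by rw [one_mul, conj_eq_iff_im, h]⟩
      · exact ⟨Complex.I, Complex.I_ne_zero, fun n => by rw [conj_eq_iff_im]; simp [h]⟩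
    refine ⟨c, hc0, fun y hy => ?_⟩
    have h1 := conj_ray_eq hQ hc hy
    have h2 := conj_ray_eq hQ hc (inv_pos.2 hy)
    have hεc : (starRingEnd ℂ) ε = ε := by rcases hε with rfl | rfl <;> simp
    -- Nothing is known about the coefficients of `f|W_N`; its reality on the axis comes from that
    -- of `f` at `y⁻¹`.
    rw [hg, ray_add_smul, ray_fricke f (by simpa using hy), ← ofReal_zpow, ← ofReal_inv,
      show c * (ray f (Real.sqrt N) y + ε * (((y ^ (-k) : ℝ) : ℂ) * ray f (Real.sqrt N) (y⁻¹ : ℝ))) =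
        c * ray f (Real.sqrt N) y + ε * (((y ^ (-k) : ℝ) : ℂ) *
          (c * ray f (Real.sqrt N) (y⁻¹ : ℝ))) by ring, map_add, h1, map_mul, map_mul, h2, hεc,
      conj_ofReal]
  · classical
    obtain ⟨s, hs⟩ := hne
    have hex := exists_coeff_ne_zero hk g hs
    have hn₀ : Nat.find hex ≠ 0 := fun h => by
      have := Nat.find_spec hex
      rw [h] at this
      exact this (coeff_zero g)
    obtain ⟨σ₁, hσ₁, h⟩ := exists_norm_natCast_cpow_mul_LSeries_sub_le (a := coeff g)
      (σ₀ := (k : ℝ) / 2 + 1) (fun s hs => (LFun_eq_LSeries hk g hs).1) hn₀ (Nat.find_spec hex)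
      (fun m hm => not_not.1 (Nat.find_min hex hm)) ((k : ℝ) / 2 + 1)
    refine ⟨σ₁, Nat.find hex, _, by linarith, hn₀, Nat.find_spec hex, fun s hs => ?_⟩
    rw [(LFun_eq_LSeries hk g (by rw [hs]; exact hσ₁)).2]
    exact h s hs

end FrickeZeros

/-! ### The substitution `y = e^x` -/

section ExpSubstitution

open MeasureTheory Complex

/-- The Mellin transform after the substitution `y = e^x`. -/
lemma mellin_eq_integral_exp (G : ℝ → ℂ) (σ t : ℝ) :
    mellin G (σ + t * Complex.I) =
      ∫ x : ℝ, (Real.exp (σ * x) * G (Real.exp x)) * Complex.exp (t * x * Complex.I) := by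
  rw [mellin_eq_fourier, Real.fourier_eq', ← integral_neg_eq_self]
  refine integral_congr_ae (Eventually.of_forall fun x => ?_)
  simp only [add_re, ofReal_re, mul_re, Complex.I_re, mul_zero, ofReal_im, Complex.I_im, mul_one, sub_self,
    add_zero, add_im, mul_im, zero_add, smul_eq_mul, RCLike.inner_apply, conj_trivial,
    Complex.real_smul, neg_neg]
  rw [mul_comm]
  congr 2
  · congr 2
    ring
  · push_cast
    have : (Real.pi : ℂ) ≠ 0 := by exact_mod_cast Real.pi_ne_zero
    field_simp

lemma integral_exp_mul_exp_neg_exp {σ a : ℝ} (hσ : 0 < σ) (ha : 0 < a) :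
    ∫ x : ℝ, Real.exp (σ * x) * Real.exp (-a * Real.exp x) = a ^ (-σ) * Real.Gamma σ := by
  have h1 := mellin_eq_integral_exp (fun y : ℝ => ((Real.exp (-a * y) : ℝ) : ℂ)) σ 0
  simp only [ofReal_zero, zero_mul, add_zero, Complex.exp_zero, mul_one] at h1
  have h2 : mellin (fun y : ℝ => ((Real.exp (-a * y) : ℝ) : ℂ)) σ =
      ((a ^ (-σ) * Real.Gamma σ : ℝ) : ℂ) := by
    have := Complex.integral_cpow_mul_exp_neg_mul_Ioi (a := (σ : ℂ)) (by simpa using hσ) ha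
    rw [mellin]
    simp only [smul_eq_mul]
    push_cast
    simp only [neg_mul] at this ⊢
    rw [this, one_div, ← ofReal_inv, ← ofReal_cpow (by positivity), Real.inv_rpow ha.le,
      Real.rpow_neg ha.le, Complex.Gamma_ofReal]
  rw [h2] at h1
  apply ofReal_injective
  rw [h1, ← integral_complex_ofReal]
  simp

lemma integrable_exp_mul_exp_neg_exp {σ a : ℝ} (hσ : 0 < σ) (ha : 0 < a) :
    Integrable fun x : ℝ => Real.exp (σ * x) * Real.exp (-a * Real.exp x) := by
  refine not_imp_comm.1 integral_undef ?_
  rw [integral_exp_mul_exp_neg_exp hσ ha]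
  have := Real.Gamma_pos_of_pos hσ
  positivity

end ExpSubstitution

/-! ### The completed `L`-function: continuation, decay and reality -/

namespace FrickeZeros

open Complex Topology MeasureTheory Asymptotics

namespace IsRotatedMellin

variable {F L : ℂ → ℂ} {κ A : ℝ}

lemma kappa_pos (h : IsRotatedMellin F L κ A) : 0 < κ := by linarith [h.one_le]

lemma isBigO_atTop (h : IsRotatedMellin F L κ A) {w : ℂ} (hw : 0 < w.re) (r : ℝ) :
    (fun y : ℝ => F (w * y)) =O[atTop] fun y => y ^ (-r) := by
  obtain ⟨C, c, hC, hc, hb⟩ := h.bound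
  have hcw : 0 < c * w.re := mul_pos hc hw
  refine IsBigO.trans ?_ (isLittleO_exp_neg_mul_rpow_atTop hcw (-r)).isBigO
  refine IsBigO.of_bound (C * w.re ^ (-(κ / 2))) ?_
  filter_upwards [eventually_ge_atTop 1] with y hy
  have hy0 : 0 < y := by linarith
  have hre : (w * y).re = w.re * y := by simp
  refine (hb (w * y) (by rw [hre]; positivity)).trans ?_
  rw [hre, Real.norm_of_nonneg (Real.exp_pos _).le, Real.mul_rpow hw.le hy0.le]
  have h1 : y ^ (-(κ / 2)) ≤ 1 :=
    Real.rpow_le_one_of_one_le_of_nonpos hy (by linarith [h.kappa_pos])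
  calc C * (w.re ^ (-(κ / 2)) * y ^ (-(κ / 2))) * Real.exp (-c * (w.re * y))
      ≤ C * (w.re ^ (-(κ / 2)) * 1) * Real.exp (-c * (w.re * y)) := by gcongr
    _ = _ := by rw [show -c * (w.re * y) = -(c * w.re) * y by ring]; ring

lemma inv_re_pos {w : ℂ} (hw : 0 < w.re) : 0 < (w⁻¹).re := by
  have hw0 : w ≠ 0 := fun h => by simp [h] at hw
  rw [Complex.inv_re]
  have := Complex.normSq_pos.2 hw0
  positivity

/-- The functional equation carries the decay at infinity along the ray of `w⁻¹` to decay at `0`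
along the ray of `w`; the factor `y^(-κ)` it introduces is why the exponent `κ - r` is used at
infinity. -/
lemma isBigO_zero (h : IsRotatedMellin F L κ A) {w : ℂ} (hw : 0 < w.re) (r : ℝ) :
    (fun y : ℝ => F (w * y)) =O[𝓝[>] 0] fun y => y ^ (-r) := by
  have hwi := inv_re_pos hw
  have h1 := (h.isBigO_atTop hwi (κ - r)).comp_tendsto tendsto_inv_nhdsGT_zero
  have h2 : (fun y : ℝ => F (w * y)) =O[𝓝[>] 0]
      fun y : ℝ => (y⁻¹) ^ κ * ‖F (w⁻¹ * (y⁻¹ : ℝ))‖ := by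
    refine IsBigO.of_bound (‖w⁻¹‖ ^ κ) ?_
    filter_upwards [self_mem_nhdsWithin] with y (hy : 0 < y)
    have hyi : 0 < y⁻¹ := inv_pos.2 hy
    have hre : 0 < (w⁻¹ * (y⁻¹ : ℝ)).re := by simpa using mul_pos hwi hyi
    have e : w * y = (w⁻¹ * (y⁻¹ : ℝ))⁻¹ := by push_cast; rw [mul_inv, inv_inv, inv_inv]
    rw [e, h.norm_inv _ hre, norm_mul, Complex.norm_real, Real.norm_of_nonneg hyi.le,
      Real.mul_rpow (norm_nonneg _) hyi.le, norm_mul, norm_norm,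
      Real.norm_of_nonneg (by positivity)]
    exact le_of_eq (by ring)
  refine h2.trans ((IsBigO.mul (isBigO_refl _ _) h1.norm_left).trans ?_)
  refine IsBigO.of_bound 1 ?_
  filter_upwards [self_mem_nhdsWithin] with y (hy : 0 < y)
  have hyi : 0 < y⁻¹ := inv_pos.2 hy
  simp only [Function.comp]
  rw [← Real.rpow_add hyi, Real.inv_rpow hy.le, ← Real.rpow_neg hy.le, one_mul]
  exact le_of_eq (by ring_nf)

lemma continuousOn_ray (h : IsRotatedMellin F L κ A) {w : ℂ} (hw : 0 < w.re) :
    ContinuousOn (fun y : ℝ => F (w * y)) (Set.Ioi 0) := by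
  refine h.continuousOn.comp (by fun_prop) fun y (hy : 0 < y) => ?_
  simpa using mul_pos hw hy

lemma differentiable_mellin (h : IsRotatedMellin F L κ A) {w : ℂ} (hw : 0 < w.re) :
    Differentiable ℂ (mellin (fun y : ℝ => F (w * y))) := fun s =>
  mellin_differentiableAt_of_isBigO_rpow
    ((h.continuousOn_ray hw).locallyIntegrableOn measurableSet_Ioi)
    (h.isBigO_atTop hw (s.re + 1)) (by linarith) (h.isBigO_zero hw (s.re - 1)) (by linarith)

/-- Both sides are analytic on `Re s > 0`, where `Γ` has no pole, and they agree on a real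
half-line. -/
lemma mellin_eq_of_re_pos (h : IsRotatedMellin F L κ A) {w : ℂ} (hw : 0 < w.re) {s : ℂ}
    (hs : 0 < s.re) : mellin (fun y : ℝ => F (w * y)) s =
      (1 / w) ^ s * (A : ℂ) ^ s * Complex.Gamma s * L s := by
  have hw0 : (1 / w) ≠ 0 := one_div_ne_zero fun h => by simp [h] at hw
  have hA0 : (A : ℂ) ≠ 0 := by exact_mod_cast h.pos.ne'
  obtain ⟨σ₀, hσ₀⟩ := h.mellin_eq
  have hopen : IsOpen {z : ℂ | 0 < z.re} := isOpen_lt continuous_const continuous_re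
  have hconv : Convex ℝ {z : ℂ | 0 < z.re} := convex_halfSpace_re_gt 0
  have hA : AnalyticOnNhd ℂ (mellin (fun y : ℝ => F (w * y))) {z : ℂ | 0 < z.re} :=
    fun z _ => (h.differentiable_mellin hw).analyticAt z
  have hB : AnalyticOnNhd ℂ (fun s => (1 / w) ^ s * (A : ℂ) ^ s * Complex.Gamma s * L s)
      {z : ℂ | 0 < z.re} := by
    refine DifferentiableOn.analyticOnNhd (fun z (hz : 0 < z.re) => ?_) hopen
    refine DifferentiableAt.differentiableWithinAt ?_
    refine ((DifferentiableAt.mul ?_ ?_).mul ?_).mul (h.differentiable z)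
    · exact differentiableAt_id.const_cpow (Or.inl hw0)
    · exact differentiableAt_id.const_cpow (Or.inl hA0)
    · refine differentiableAt_Gamma _ fun m hm => ?_
      rw [hm] at hz
      simp at hz
      linarith [(m.cast_nonneg : (0 : ℝ) ≤ m)]
  set p : ℝ := max σ₀ 0 + 1
  have hp1 : σ₀ < p := by linarith [le_max_left σ₀ 0]
  have hp0 : 0 < p := by linarith [le_max_right σ₀ 0]
  have ht : Tendsto (fun x : ℝ => (x : ℂ)) (𝓝[>] p) (𝓝[≠] (p : ℂ)) := by
    refine tendsto_nhdsWithin_iff.2 ⟨?_, ?_⟩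
    · exact (continuous_ofReal.tendsto p).mono_left nhdsWithin_le_nhds
    · filter_upwards [self_mem_nhdsWithin] with x (hx : p < x)
      simpa using hx.ne'
  refine hA.eqOn_of_preconnected_of_frequently_eq hB hconv.isPreconnected
    (show (p : ℂ) ∈ {z : ℂ | 0 < z.re} by simpa using hp0) (ht.frequently
      (Eventually.frequently ?_)) hs
  filter_upwards [self_mem_nhdsWithin] with x (hx : p < x)
  exact hσ₀ w hw x (hp1.trans hx)

/-- The integrand of the Mellin transform along the ray through `w`, in the variable `log y`. -/
noncomputable def expRay (F : ℂ → ℂ) (w : ℂ) (σ x : ℝ) : ℂ :=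
  Real.exp (σ * x) * F (w * (Real.exp x : ℝ))

lemma continuous_expRay (h : IsRotatedMellin F L κ A) {w : ℂ} (hw : 0 < w.re) (σ : ℝ) :
    Continuous (expRay F w σ) := by
  refine Continuous.mul (by fun_prop) ?_
  exact (h.continuousOn_ray hw).comp_continuous (by fun_prop) fun x => Real.exp_pos x

lemma expRay_isBigO_atTop (h : IsRotatedMellin F L κ A) {w : ℂ} (hw : 0 < w.re) (σ : ℝ) :
    expRay F w σ =O[atTop] fun x => Real.exp (-x) := by
  have h1 := (h.isBigO_atTop hw (σ + 1)).comp_tendsto Real.tendsto_exp_atTop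
  have h2 : (fun x : ℝ => ((Real.exp (σ * x) : ℝ) : ℂ)) =O[atTop] fun x => Real.exp (σ * x) :=
    IsBigO.of_bound 1 (Eventually.of_forall fun x => by rw [Complex.norm_real, one_mul])
  refine (h2.mul h1).trans (IsBigO.of_bound 1 (Eventually.of_forall fun x => ?_))
  simp only [Function.comp]
  rw [← Real.exp_mul, ← Real.exp_add, one_mul]
  exact le_of_eq (by ring_nf)

lemma expRay_isBigO_atBot (h : IsRotatedMellin F L κ A) {w : ℂ} (hw : 0 < w.re) (σ : ℝ) :
    expRay F w σ =O[atBot] fun x => Real.exp x := by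
  have h1 := (h.isBigO_zero hw (σ - 1)).comp_tendsto Real.tendsto_exp_atBot_nhdsGT
  have h2 : (fun x : ℝ => ((Real.exp (σ * x) : ℝ) : ℂ)) =O[atBot] fun x => Real.exp (σ * x) :=
    IsBigO.of_bound 1 (Eventually.of_forall fun x => by rw [Complex.norm_real, one_mul])
  refine (h2.mul h1).trans (IsBigO.of_bound 1 (Eventually.of_forall fun x => ?_))
  simp only [Function.comp]
  rw [← Real.exp_mul, ← Real.exp_add, one_mul]
  exact le_of_eq (by ring_nf)

lemma integrable_expRay (h : IsRotatedMellin F L κ A) {w : ℂ} (hw : 0 < w.re) (σ : ℝ) :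
    Integrable (expRay F w σ) :=
  (h.continuous_expRay hw σ).locallyIntegrable.integrable_of_isBigO_atBot_atTop
    (h.expRay_isBigO_atBot hw σ) ⟨Set.Iic 0, Iic_mem_atBot 0, integrableOn_exp_Iic 0⟩
    (h.expRay_isBigO_atTop hw σ) ⟨Set.Ioi 0, Ioi_mem_atTop 0, integrableOn_exp_neg_Ioi 0⟩

lemma memLp_two_expRay (h : IsRotatedMellin F L κ A) {w : ℂ} (hw : 0 < w.re) (σ : ℝ) :
    MemLp (expRay F w σ) 2 := by
  have hc := h.continuous_expRay hw σ
  rw [memLp_two_iff_integrable_sq_norm hc.aestronglyMeasurable]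
  have h1 := (h.expRay_isBigO_atBot hw σ).norm_left.pow 2
  have h2 := (h.expRay_isBigO_atTop hw σ).norm_left.pow 2
  have e1 : (fun x => Real.exp x ^ 2) =O[atBot] fun x : ℝ => Real.exp x := by
    refine IsBigO.of_bound 1 ?_
    filter_upwards [eventually_le_atBot 0] with x hx
    rw [one_mul, norm_pow, Real.norm_of_nonneg (Real.exp_pos x).le]
    exact pow_le_of_le_one (Real.exp_pos x).le (Real.exp_le_one_iff.2 hx) two_ne_zero
  have e2 : (fun x => Real.exp (-x) ^ 2) =O[atTop] fun x : ℝ => Real.exp (-x) := by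
    refine IsBigO.of_bound 1 ?_
    filter_upwards [eventually_ge_atTop 0] with x hx
    rw [one_mul, norm_pow, Real.norm_of_nonneg (Real.exp_pos _).le]
    exact pow_le_of_le_one (Real.exp_pos _).le (Real.exp_le_one_iff.2 (by linarith)) two_ne_zero
  exact (hc.norm.pow 2).locallyIntegrable.integrable_of_isBigO_atBot_atTop
    (h1.trans e1) ⟨Set.Iic 0, Iic_mem_atBot 0, integrableOn_exp_Iic 0⟩
    (h2.trans e2) ⟨Set.Ioi 0, Ioi_mem_atTop 0, integrableOn_exp_neg_Ioi 0⟩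

lemma mellin_eq_integral_expRay (F : ℂ → ℂ) (w : ℂ) (σ t : ℝ) :
    mellin (fun y : ℝ => F (w * y)) (σ + t * Complex.I) =
      ∫ x : ℝ, expRay F w σ x * Complex.exp (t * x * Complex.I) :=
  mellin_eq_integral_exp _ σ t

/-- On the critical line, the completed `L`-function is real up to a constant. -/
lemma exists_im_eq_zero (h : IsRotatedMellin F L κ A) : ∃ c : ℂ, c ≠ 0 ∧ ∀ t : ℝ,
    (c * mellin (fun y : ℝ => F y) ((κ / 2 : ℝ) + t * Complex.I)).im = 0 := by
  obtain ⟨ε, hε, hfe⟩ := h.inv_real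
  obtain ⟨c, hc, hconj⟩ := h.conj_real
  set M := mellin (fun y : ℝ => F y) with hM
  have h1 (s : ℂ) : M (κ - s) = ε * M s := by
    have e1 : M (-(s - κ)) = mellin (fun y : ℝ => F ((y⁻¹ : ℝ) : ℂ)) (s - κ) :=
      (mellin_comp_inv (fun y : ℝ => F y) (s - κ)).symm
    rw [show (κ : ℂ) - s = -(s - κ) by ring, e1]
    have e2 : mellin (fun y : ℝ => F ((y⁻¹ : ℝ) : ℂ)) (s - κ) =
        mellin (fun y : ℝ => (y : ℂ) ^ (κ : ℂ) • (ε • F y)) (s - κ) := by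
      refine setIntegral_congr_fun measurableSet_Ioi fun y (hy : 0 < y) => ?_
      simp only [smul_eq_mul]
      rw [ofReal_inv, hfe y hy]
      ring
    rw [e2, mellin_cpow_smul, sub_add_cancel, mellin_const_smul, smul_eq_mul]
  have h2 (s : ℂ) : (starRingEnd ℂ) (c * M s) = c * M ((starRingEnd ℂ) s) := by
    have e1 (s : ℂ) : c * M s = ∫ y in Set.Ioi (0 : ℝ), (y : ℂ) ^ (s - 1) * (c * F y) := by
      rw [hM, mellin, ← integral_const_mul]
      refine setIntegral_congr_fun measurableSet_Ioi fun y _ => ?_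
      simp only [smul_eq_mul]
      ring
    rw [e1, e1, ← integral_conj]
    refine setIntegral_congr_fun measurableSet_Ioi fun y (hy : 0 < y) => ?_
    rw [map_mul, hconj y hy, show (starRingEnd ℂ) s - 1 = (starRingEnd ℂ) (s - 1) by simp,
      cpow_conj _ _ (by rw [arg_ofReal_of_nonneg hy.le]; exact Real.pi_ne_zero.symm), conj_ofReal]
  -- On the critical line `κ - s` is the conjugate of `s`, so the functional equation and the
  -- reflection principle combine. For `ε = -1` the value is purely imaginary, which a further
  -- factor `i` corrects.
  have h3 (t : ℝ) : (starRingEnd ℂ) (c * M ((κ / 2 : ℝ) + t * Complex.I)) =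
      ε * (c * M ((κ / 2 : ℝ) + t * Complex.I)) := by
    rw [h2, mul_left_comm, ← h1]
    congr 2
    simp only [map_add, map_mul, conj_ofReal, conj_I]
    push_cast
    ring
  rcases hε with rfl | rfl
  · refine ⟨c, hc, fun t => ?_⟩
    rw [← conj_eq_iff_im, h3, one_mul]
  · refine ⟨Complex.I * c, mul_ne_zero Complex.I_ne_zero hc, fun t => ?_⟩
    rw [← conj_eq_iff_im, mul_assoc, map_mul, h3, conj_I]
    ring

end IsRotatedMellin

end FrickeZeros

/-! ### Mean squares along the tilted ray -/

namespace FrickeZeros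

open Complex Topology MeasureTheory Asymptotics

/-- The point `e^{i(π/2 - 1/T)}`. -/
noncomputable def tilt (T : ℝ) : ℂ := Complex.exp ((Real.pi / 2 - 1 / T : ℝ) * Complex.I)

/-- The real part is `sin(1/T)`, bounded below by Jordan's inequality. It governs the size of `F` on
the tilted ray, so every power of `T` in the upper bounds comes from here. -/
lemma tilt_re_ge {T : ℝ} (hT : 1 ≤ T) : 1 / (2 * T) ≤ (tilt T).re := by
  have hT0 : 0 < T := by linarith
  have h1 : (tilt T).re = Real.sin (1 / T) := by
    rw [tilt, Complex.exp_ofReal_mul_I_re, Real.cos_pi_div_two_sub]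
  have h2 : 1 / T ≤ Real.pi / 2 := by
    have : 1 / T ≤ 1 := by rw [div_le_one hT0]; exact hT
    linarith [Real.pi_gt_three]
  rw [h1]
  refine le_trans ?_ (Real.mul_le_sin (by positivity) h2)
  rw [div_mul_div_comm, div_le_div_iff₀ (by positivity) (by have := Real.pi_pos; positivity)]
  nlinarith [Real.pi_le_four]

lemma tilt_re_pos {T : ℝ} (hT : 1 ≤ T) : 0 < (tilt T).re :=
  lt_of_lt_of_le (by positivity) (tilt_re_ge hT)

/-- This is the exponential growth that offsets the decay of `Γ`. The angle lies within the range of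
the principal logarithm, so no branch correction occurs. -/
lemma norm_one_div_tilt_cpow {T : ℝ} (hT : 1 ≤ T) (s : ℂ) :
    ‖(1 / tilt T) ^ s‖ = Real.exp ((Real.pi / 2 - 1 / T) * s.im) := by
  have h0 : 1 / tilt T = Complex.exp ((-(Real.pi / 2 - 1 / T) : ℝ) * Complex.I) := by
    rw [tilt, one_div, ← Complex.exp_neg]
    push_cast
    ring_nf
  have hT' : 0 < 1 / T := by positivity
  have hT'' : 1 / T ≤ 1 := by rw [div_le_one (by linarith)]; exact hT
  have hpi := Real.pi_gt_three
  have him : (((-(Real.pi / 2 - 1 / T) : ℝ) : ℂ) * Complex.I).im = -(Real.pi / 2 - 1 / T) := by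
    rw [mul_I_im, ofReal_re]
  rw [h0, cpow_def_of_ne_zero (Complex.exp_ne_zero _), Complex.log_exp (by rw [him]; linarith)
    (by rw [him]; linarith), Complex.norm_exp]
  congr 1
  simp
  ring

namespace IsRotatedMellin

variable {F L : ℂ → ℂ} {κ A : ℝ}

/-- The product of `e^{(π/2 - 1/T)t}` and `e^{-πt/2}` is `e^{-t/T} ≥ e^{-3}`. The range up to `3T`
accommodates windows of length at most `T` that start in `[T, 2T]`. -/
lemma exists_norm_L_le (h : IsRotatedMellin F L κ A) : ∃ c : ℝ, 0 < c ∧ ∀ T σ t : ℝ, 1 ≤ T →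
    1 / 2 ≤ σ → T ≤ t → t ≤ 3 * T → c * A ^ σ * T ^ (σ - 1 / 2) * ‖L (σ + t * Complex.I)‖ ≤
      ‖mellin (fun y : ℝ => F (tilt T * y)) (σ + t * Complex.I)‖ := by
  obtain ⟨c, hc, hG⟩ := exists_rpow_mul_exp_le_norm_Gamma
  refine ⟨c * Real.exp (-3), by positivity, fun T σ t hT hσ ht1 ht2 => ?_⟩
  have hT0 : 0 < T := by linarith
  have hA := h.pos
  have hg := hG σ t hσ (hT.trans ht1)
  rw [h.mellin_eq_of_re_pos (tilt_re_pos hT) (by simp; linarith), norm_mul, norm_mul, norm_mul,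
    norm_one_div_tilt_cpow hT, norm_cpow_eq_rpow_re_of_pos hA]
  have him : ((σ : ℂ) + t * Complex.I).im = t := by simp
  have hre : ((σ : ℂ) + t * Complex.I).re = σ := by simp
  rw [him, hre]
  refine mul_le_mul_of_nonneg_right ?_ (norm_nonneg _)
  have h1 : Real.exp (-3) ≤ Real.exp ((Real.pi / 2 - 1 / T) * t) *
      Real.exp (-(Real.pi * t / 2)) := by
    rw [← Real.exp_add]
    apply Real.exp_le_exp.2
    have : 1 / T * t ≤ 3 := by rw [div_mul_eq_mul_div, div_le_iff₀ hT0]; linarith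
    linarith
  have ht0 : 0 < t := by linarith
  have h2 : T ^ (σ - 1 / 2) ≤ t ^ (σ - 1 / 2) :=
    Real.rpow_le_rpow hT0.le ht1 (by linarith)
  calc c * Real.exp (-3) * A ^ σ * T ^ (σ - 1 / 2)
      = A ^ σ * (c * T ^ (σ - 1 / 2) * Real.exp (-3)) := by ring
    _ ≤ A ^ σ * (c * t ^ (σ - 1 / 2) * (Real.exp ((Real.pi / 2 - 1 / T) * t) *
      Real.exp (-(Real.pi * t / 2)))) := by gcongr
    _ = Real.exp ((Real.pi / 2 - 1 / T) * t) * A ^ σ *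
        (c * t ^ (σ - 1 / 2) * Real.exp (-(Real.pi * t / 2))) := by ring
    _ ≤ _ := by gcongr

/-- Mean square of `L` on vertical lines to the right of the critical line. -/
lemma exists_integral_norm_sq_L_le (h : IsRotatedMellin F L κ A) (σ₁ : ℝ) :
    ∃ B : ℝ, 0 < B ∧ ∀ T σ : ℝ, 1 ≤ T → κ / 2 < σ → σ ≤ σ₁ →
      ∫ t in T..(3 * T), ‖L (σ + t * Complex.I)‖ ^ 2 ≤ B * T / (σ - κ / 2) := by
  obtain ⟨c₁, hc₁, hlow⟩ := h.exists_norm_L_le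
  obtain ⟨C, c, hC, hc, hb⟩ := h.bound
  have hA := h.pos
  have hκ := h.one_le
  -- All factors depending on `σ` are bounded by compactness once the pole of `Γ(2σ - κ)` at the
  -- critical line is split off through `Γ(x) = Γ(x + 1)/x`; that pole is the denominator in the
  -- bound.
  have hcont : ContinuousOn (fun σ : ℝ => (2 * c) ^ (-(2 * σ - κ)) * (2 / A) ^ (2 * σ) *
      Real.Gamma (2 * σ - κ + 1)) (Set.Icc (κ / 2) σ₁) := by
    refine ContinuousOn.mul (Continuous.continuousOn ?_) fun σ hσ => ?_
    · refine Continuous.mul ?_ ?_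
      · exact continuous_const.rpow (by fun_prop) fun _ => Or.inl (by positivity)
      · exact continuous_const.rpow (by fun_prop) fun _ => Or.inl (by positivity)
    · have hσ1 := hσ.1
      refine ContinuousAt.continuousWithinAt ?_
      refine ContinuousAt.comp (g := Real.Gamma) ?_ (by fun_prop)
      refine (Real.differentiableAt_Gamma fun m hm => ?_).continuousAt
      linarith [(m.cast_nonneg : (0 : ℝ) ≤ m)]
  obtain ⟨B₀, hB₀⟩ := isCompact_Icc.exists_bound_of_continuousOn hcont
  refine ⟨(2 * Real.pi * C ^ 2 / c₁ ^ 2) * (|B₀| + 1), by have := Real.pi_pos; positivity,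
    fun T σ hT hσ hσ₁ => ?_⟩
  have hT0 : 0 < T := by linarith
  have hσ0 : 0 < σ := by linarith
  have hs : 0 < 2 * σ - κ := by linarith
  set w := tilt T with hw
  have hwre : 0 < w.re := tilt_re_pos hT
  set M : ℝ → ℂ := fun t => mellin (fun y : ℝ => F (w * y)) (σ + t * Complex.I) with hM
  obtain ⟨hi, he⟩ := integral_norm_sq_integral_mul_exp (h.integrable_expRay hwre σ)
    (h.memLp_two_expRay hwre σ)
  simp only [← mellin_eq_integral_expRay] at hi he
  have hcw : 0 < 2 * (c * w.re) := by positivity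
  have hpt (x : ℝ) : ‖expRay F w σ x‖ ^ 2 ≤ C ^ 2 * w.re ^ (-κ) *
      (Real.exp ((2 * σ - κ) * x) * Real.exp (-(2 * (c * w.re)) * Real.exp x)) := by
    have hx := Real.exp_pos x
    have hre : (w * (Real.exp x : ℝ)).re = w.re * Real.exp x := by simp [-ofReal_exp]
    have h1 := hb (w * (Real.exp x : ℝ)) (by rw [hre]; positivity)
    rw [hre] at h1
    have h2 : ‖expRay F w σ x‖ ≤ Real.exp (σ * x) * (C * (w.re * Real.exp x) ^ (-(κ / 2)) *
        Real.exp (-c * (w.re * Real.exp x))) := by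
      rw [expRay, norm_mul, Complex.norm_real, Real.norm_of_nonneg (Real.exp_pos _).le]
      gcongr
    refine (pow_le_pow_left₀ (norm_nonneg _) h2 2).trans (le_of_eq ?_)
    rw [mul_pow, mul_pow, mul_pow, ← Real.rpow_mul_natCast (by positivity),
      Real.mul_rpow hwre.le hx.le, ← Real.exp_mul, ← Real.exp_nat_mul, ← Real.exp_nat_mul,
      show 2 * σ - κ = 2 * σ + -κ by ring, add_mul (2 * σ), Real.exp_add]
    push_cast
    rw [show -(κ / 2) * 2 = -κ by ring, show (2 : ℝ) * (σ * x) = 2 * σ * x by ring,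
      show x * -κ = -κ * x by ring, show (2 : ℝ) * (-c * (w.re * Real.exp x)) =
        -(2 * (c * w.re)) * Real.exp x by ring]
    ring
  have hΦ : ∫ x, ‖expRay F w σ x‖ ^ 2 ≤ C ^ 2 * w.re ^ (-κ) *
      ((2 * (c * w.re)) ^ (-(2 * σ - κ)) * Real.Gamma (2 * σ - κ)) := by
    rw [← integral_exp_mul_exp_neg_exp hs hcw, ← integral_const_mul]
    exact integral_mono_of_nonneg (Eventually.of_forall fun _ => by positivity)
      ((integrable_exp_mul_exp_neg_exp hs hcw).const_mul _) (Eventually.of_forall hpt)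
  have hLc : Continuous fun t : ℝ => ‖L (σ + t * Complex.I)‖ ^ 2 :=
    ((h.differentiable.continuous.comp (by fun_prop)).norm).pow 2
  have hlow2 : (c₁ * A ^ σ * T ^ (σ - 1 / 2)) ^ 2 *
      ∫ t in T..(3 * T), ‖L (σ + t * Complex.I)‖ ^ 2 ≤ ∫ t, ‖M t‖ ^ 2 := by
    rw [intervalIntegral.integral_of_le (by linarith), ← integral_const_mul]
    refine le_trans (setIntegral_mono_on ?_ hi.integrableOn measurableSet_Ioc fun t ht => ?_)
      (setIntegral_le_integral hi (Eventually.of_forall fun _ => by positivity))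
    · exact ((hLc.const_mul _).integrableOn_Icc).mono_set Set.Ioc_subset_Icc_self
    · have := hlow T σ t hT (by linarith) ht.1.le ht.2
      rw [← mul_pow]
      exact pow_le_pow_left₀ (by positivity) this 2
  set J := ∫ t in T..(3 * T), ‖L (σ + t * Complex.I)‖ ^ 2
  have hfin := hlow2.trans (he.le.trans (mul_le_mul_of_nonneg_left hΦ Real.two_pi_pos.le))
  have hΓ : Real.Gamma (2 * σ - κ) = Real.Gamma (2 * σ - κ + 1) / (2 * σ - κ) := by
    rw [Real.Gamma_add_one hs.ne']; field_simp
  have hΓpos : 0 < Real.Gamma (2 * σ - κ) := Real.Gamma_pos_of_pos hs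
  have hη : w.re ^ (-(2 * σ)) ≤ (2 * T) ^ (2 * σ) := by
    have := Real.rpow_le_rpow_of_nonpos (z := -(2 * σ)) (by positivity) (tilt_re_ge hT)
      (by linarith)
    refine this.trans (le_of_eq ?_)
    rw [one_div, Real.inv_rpow (by positivity), Real.rpow_neg (by positivity), inv_inv]
  have hB := hB₀ σ ⟨hσ.le, hσ₁⟩
  have hB' : (2 * c) ^ (-(2 * σ - κ)) * (2 / A) ^ (2 * σ) * Real.Gamma (2 * σ - κ + 1) ≤
      |B₀| + 1 := by
    refine (le_abs_self _).trans ?_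
    rw [← Real.norm_eq_abs]
    linarith [le_abs_self B₀]
  -- The lower bound carries `T^(2σ-1)` and the upper bound `(Re w)^(-2σ) ≤ (2T)^(2σ)`, so a single
  -- factor `T` survives.
  have e1 : (c₁ * A ^ σ * T ^ (σ - 1 / 2)) ^ 2 = c₁ ^ 2 * A ^ (2 * σ) * T ^ (2 * σ) * T⁻¹ := by
    rw [mul_pow, mul_pow, ← Real.rpow_mul_natCast hA.le, ← Real.rpow_mul_natCast hT0.le]
    push_cast
    rw [show (σ - 1 / 2) * 2 = 2 * σ + -1 by ring, Real.rpow_add hT0, Real.rpow_neg_one,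
      mul_comm σ 2]
    ring
  have e2 : w.re ^ (-κ) * (2 * (c * w.re)) ^ (-(2 * σ - κ)) =
      (2 * c) ^ (-(2 * σ - κ)) * w.re ^ (-(2 * σ)) := by
    rw [← mul_assoc, Real.mul_rpow (by positivity) hwre.le,
      show -(2 * σ) = -κ + -(2 * σ - κ) by ring, Real.rpow_add hwre]
    ring
  have hX : 0 < c₁ ^ 2 * A ^ (2 * σ) * T ^ (2 * σ) * T⁻¹ := by positivity
  rw [e1] at hfin
  refine le_of_mul_le_mul_left ?_ hX
  refine hfin.trans ?_
  have e3 : (2 * T) ^ (2 * σ) = (2 / A) ^ (2 * σ) * (A ^ (2 * σ) * T ^ (2 * σ)) := by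
    rw [← Real.mul_rpow (by positivity) (by positivity),
      ← Real.mul_rpow (by positivity) (by positivity)]
    congr 1
    field_simp
  have hd : 0 < σ - κ / 2 := by linarith
  calc 2 * Real.pi * (C ^ 2 * w.re ^ (-κ) *
        ((2 * (c * w.re)) ^ (-(2 * σ - κ)) * Real.Gamma (2 * σ - κ)))
      = 2 * Real.pi * C ^ 2 * (w.re ^ (-κ) * (2 * (c * w.re)) ^ (-(2 * σ - κ))) *
        Real.Gamma (2 * σ - κ) := by ring
    _ = 2 * Real.pi * C ^ 2 * ((2 * c) ^ (-(2 * σ - κ)) * w.re ^ (-(2 * σ))) *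
        Real.Gamma (2 * σ - κ) := by rw [e2]
    _ ≤ 2 * Real.pi * C ^ 2 * ((2 * c) ^ (-(2 * σ - κ)) * (2 * T) ^ (2 * σ)) *
        Real.Gamma (2 * σ - κ) := by
        have := Real.pi_pos
        gcongr
    _ = 2 * Real.pi * C ^ 2 * (A ^ (2 * σ) * T ^ (2 * σ)) * ((2 * c) ^ (-(2 * σ - κ)) *
        (2 / A) ^ (2 * σ) * Real.Gamma (2 * σ - κ + 1)) / (2 * σ - κ) := by
        rw [hΓ, e3]; ring
    _ ≤ 2 * Real.pi * C ^ 2 * (A ^ (2 * σ) * T ^ (2 * σ)) * (|B₀| + 1) / (2 * σ - κ) := by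
        have := Real.pi_pos
        gcongr
    _ ≤ 2 * Real.pi * C ^ 2 * (A ^ (2 * σ) * T ^ (2 * σ)) * (|B₀| + 1) / (σ - κ / 2) := by
        have := Real.pi_pos
        exact div_le_div_of_nonneg_left (by positivity) hd (by linarith)
    _ = _ := by field_simp

/-- Mean square over `t` of the integral over `[t, t + H]` of the completed `L`-function. -/
lemma exists_integral_norm_sq_integral_le (h : IsRotatedMellin F L κ A) :
    ∃ B : ℝ, 0 < B ∧ ∀ T H : ℝ, 1 ≤ T → 0 < H →
      Integrable (fun t : ℝ => ‖∫ v in (0 : ℝ)..H, mellin (fun y : ℝ => F (tilt T * y))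
        ((κ / 2 : ℝ) + (t + v : ℝ) * Complex.I)‖ ^ 2) ∧
      ∫ t : ℝ, ‖∫ v in (0 : ℝ)..H, mellin (fun y : ℝ => F (tilt T * y))
        ((κ / 2 : ℝ) + (t + v : ℝ) * Complex.I)‖ ^ 2 ≤ B * H * T ^ κ := by
  obtain ⟨C, c, hC, hc, hb⟩ := h.bound
  have hκ := h.kappa_pos
  refine ⟨(2 * Real.pi) ^ 2 * C ^ 2 * 2 ^ κ, by have := Real.pi_pos; positivity,
    fun T H hT hH => ?_⟩
  have hT0 : 0 < T := by linarith
  set w := tilt T with hw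
  have hwre : 0 < w.re := tilt_re_pos hT
  set Φ := expRay F w (κ / 2) with hΦ
  have hΦi : Integrable Φ := h.integrable_expRay hwre _
  -- At `σ = κ/2` the factor `e^(κx/2)` exactly cancels the growth of `F` at `0`, giving a bound of
  -- order `T^(κ/2)` uniform in `x`.
  have hΦb (x : ℝ) : ‖Φ x‖ ≤ C * w.re ^ (-(κ / 2)) := by
    have hx := Real.exp_pos x
    have hre : (w * (Real.exp x : ℝ)).re = w.re * Real.exp x := by simp [-ofReal_exp]
    have h1 := hb (w * (Real.exp x : ℝ)) (by rw [hre]; positivity)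
    rw [hre] at h1
    rw [hΦ, expRay, norm_mul, Complex.norm_real, Real.norm_of_nonneg (Real.exp_pos _).le]
    calc Real.exp (κ / 2 * x) * ‖F (w * (Real.exp x : ℝ))‖
        ≤ Real.exp (κ / 2 * x) * (C * (w.re * Real.exp x) ^ (-(κ / 2)) * 1) := by
          gcongr
          refine h1.trans ?_
          gcongr
          apply Real.exp_le_one_iff.2
          have : 0 < c * (w.re * Real.exp x) := by positivity
          linarith
      _ = C * w.re ^ (-(κ / 2)) * (Real.exp (κ / 2 * x) * Real.exp (x * -(κ / 2))) := by
          rw [Real.mul_rpow hwre.le hx.le, ← Real.exp_mul]; ring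
      _ = _ := by rw [← Real.exp_add]; ring_nf; simp
  -- Integrating over the window multiplies `Φ` by `E`, the transform of the indicator of `(0, H]`.
  -- A second use of Plancherel gives `∫ |E|² = 2πH`: the bound is linear in `H`, where the trivial
  -- one would be quadratic.
  set E : ℝ → ℂ := fun x => ∫ v in (0 : ℝ)..H, Complex.exp (x * v * Complex.I) with hE
  have hEb (x : ℝ) : ‖E x‖ ≤ H := by
    have := intervalIntegral.norm_integral_le_of_norm_le_const (a := (0 : ℝ)) (b := H)
      (f := fun v : ℝ => Complex.exp (x * v * Complex.I)) (C := 1) fun v _ => by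
        rw [← ofReal_mul, Complex.norm_exp_ofReal_mul_I]
    simpa [abs_of_pos hH] using this
  have hEc : Continuous E :=
    intervalIntegral.continuous_parametric_intervalIntegral_of_continuous' (by fun_prop) 0 H
  have hind : E = fun t : ℝ => ∫ x : ℝ, (Set.Ioc 0 H).indicator (1 : ℝ → ℂ) x *
      Complex.exp (t * x * Complex.I) := by
    funext t
    rw [hE]
    simp only
    rw [intervalIntegral.integral_of_le hH.le, ← integral_indicator measurableSet_Ioc]
    congr 1
    ext x
    by_cases hx : x ∈ Set.Ioc 0 H <;> simp [hx]
  have hEL2 : Integrable (fun x => ‖E x‖ ^ 2) ∧ ∫ x, ‖E x‖ ^ 2 = 2 * Real.pi * H := by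
    have h1 : Integrable ((Set.Ioc 0 H).indicator (1 : ℝ → ℂ)) :=
      (integrable_indicator_iff measurableSet_Ioc).2 (by
        exact integrableOn_const (by simp) (by simp))
    have h2 : MemLp ((Set.Ioc 0 H).indicator (1 : ℝ → ℂ)) 2 :=
      memLp_indicator_const 2 measurableSet_Ioc (1 : ℂ) (Or.inr (by simp))
    obtain ⟨i1, i2⟩ := integral_norm_sq_integral_mul_exp h1 h2
    rw [hind]
    refine ⟨i1, i2.trans ?_⟩
    congr 1
    have : (fun x => ‖(Set.Ioc 0 H).indicator (1 : ℝ → ℂ) x‖ ^ 2) =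
        (Set.Ioc 0 H).indicator (fun _ => (1 : ℝ)) := by
      funext x
      by_cases hx : x ∈ Set.Ioc 0 H <;> simp [hx]
    rw [this, integral_indicator measurableSet_Ioc]
    simp [hH.le]
  have hΨc : Continuous fun x => Φ x * E x := (h.continuous_expRay hwre _).mul hEc
  have hΨi : Integrable fun x => Φ x * E x :=
    hΦi.mul_bdd (c := H) hEc.aestronglyMeasurable (Eventually.of_forall hEb)
  have hΨb (x : ℝ) : ‖Φ x * E x‖ ^ 2 ≤ (C * w.re ^ (-(κ / 2))) ^ 2 * ‖E x‖ ^ 2 := by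
    rw [norm_mul, mul_pow]
    gcongr
    exact hΦb x
  have hΨsq : Integrable fun x => ‖Φ x * E x‖ ^ 2 :=
    (hEL2.1.const_mul _).mono' (hΨc.norm.pow 2).aestronglyMeasurable
      (Eventually.of_forall fun x => by
        rw [Real.norm_of_nonneg (by positivity)]; exact hΨb x)
  have hΨ2 : MemLp (fun x => Φ x * E x) 2 :=
    (memLp_two_iff_integrable_sq_norm hΨc.aestronglyMeasurable).2 hΨsq
  have key (t : ℝ) : ∫ v in (0 : ℝ)..H, mellin (fun y : ℝ => F (w * y))
        ((κ / 2 : ℝ) + (t + v : ℝ) * Complex.I) =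
      ∫ x : ℝ, Φ x * E x * Complex.exp (t * x * Complex.I) := by
    simp only [mellin_eq_integral_expRay]
    rw [intervalIntegral.integral_of_le hH.le, integral_integral_swap]
    · refine integral_congr_ae (Eventually.of_forall fun x => ?_)
      simp only [hE]
      rw [intervalIntegral.integral_of_le hH.le, mul_right_comm, ← integral_const_mul]
      refine integral_congr_ae (Eventually.of_forall fun v => ?_)
      simp only
      rw [mul_assoc (Φ x), ← Complex.exp_add]
      congr 2
      push_cast
      ring
    · have h1 : Integrable (fun p : ℝ × ℝ => (1 : ℂ) * Φ p.2)
          ((volume.restrict (Set.Ioc 0 H)).prod volume) :=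
        Integrable.mul_prod (f := fun _ : ℝ => (1 : ℂ)) (integrable_const _) hΦi
      have h2 := h1.mul_bdd (g := fun p : ℝ × ℝ => Complex.exp ((t + p.1 : ℝ) * p.2 * Complex.I)) (c := 1)
        (Continuous.aestronglyMeasurable (by fun_prop)) (Eventually.of_forall fun p => by
          rw [← ofReal_mul, Complex.norm_exp_ofReal_mul_I])
      simpa [Function.uncurry] using! h2
  obtain ⟨i1, i2⟩ := integral_norm_sq_integral_mul_exp hΨi hΨ2
  simp only [key]
  refine ⟨i1, i2.le.trans ?_⟩
  have h3 : ∫ x, ‖Φ x * E x‖ ^ 2 ≤ (C * w.re ^ (-(κ / 2))) ^ 2 * (2 * Real.pi * H) := by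
    rw [← hEL2.2, ← integral_const_mul]
    exact integral_mono hΨsq (hEL2.1.const_mul _) hΨb
  have h4 : (w.re ^ (-(κ / 2))) ^ 2 ≤ 2 ^ κ * T ^ κ := by
    rw [← Real.rpow_mul_natCast hwre.le]
    push_cast
    rw [show -(κ / 2) * 2 = -κ by ring]
    have := Real.rpow_le_rpow_of_nonpos (z := -κ) (by positivity) (tilt_re_ge hT) (by linarith)
    refine this.trans (le_of_eq ?_)
    rw [one_div, Real.inv_rpow (by positivity), Real.rpow_neg (by positivity), inv_inv,
      Real.mul_rpow (by norm_num) hT0.le]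
  calc 2 * Real.pi * ∫ x, ‖Φ x * E x‖ ^ 2
      ≤ 2 * Real.pi * ((C * w.re ^ (-(κ / 2))) ^ 2 * (2 * Real.pi * H)) := by
        have := Real.pi_pos
        gcongr
    _ = 2 * Real.pi * (C ^ 2 * (w.re ^ (-(κ / 2))) ^ 2 * (2 * Real.pi * H)) := by ring
    _ ≤ 2 * Real.pi * (C ^ 2 * (2 ^ κ * T ^ κ) * (2 * Real.pi * H)) := by
        have := Real.pi_pos
        gcongr
    _ = _ := by ring

end IsRotatedMellin

end FrickeZeros

/-! ### Zeros of odd order and sign changes -/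

section SignChanges

open Complex Topology

lemma tendsto_add_ofReal_mul_I_nhdsNE (p : ℂ) (u : ℝ) :
    Tendsto (fun v : ℝ => p + v * Complex.I) (𝓝[≠] u) (𝓝[≠] (p + u * Complex.I)) := by
  refine tendsto_nhdsWithin_iff.2 ⟨?_, ?_⟩
  · have : Continuous fun v : ℝ => p + v * Complex.I := by fun_prop
    exact (this.tendsto u).mono_left nhdsWithin_le_nhds
  · filter_upwards [self_mem_nhdsWithin] with v (hv : v ≠ u)
    simpa [Complex.I_ne_zero] using hv

lemma eq_zero_of_frequently_eq_zero_line {f : ℂ → ℂ} (hf : Differentiable ℂ f) {p : ℂ} {u : ℝ}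
    (h : ∃ᶠ v : ℝ in 𝓝[≠] u, f (p + v * Complex.I) = 0) (s : ℂ) : f s = 0 := by
  have h1 := (tendsto_add_ofReal_mul_I_nhdsNE p u).frequently (p := fun z => f z = 0) h
  exact AnalyticOnNhd.eqOn_zero_of_preconnected_of_frequently_eq_zero
    (fun z _ => hf.analyticAt z) isPreconnected_univ (Set.mem_univ _) h1 (Set.mem_univ s)

/-- Near a point where it has no zero of odd order, a function that is real on a vertical line
does not change sign. -/
lemma eventually_nonneg_or_nonpos_of_not_isOddZero {f : ℂ → ℂ} (hf : Differentiable ℂ f) {s₁ : ℂ}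
    (hs₁ : f s₁ ≠ 0) {p : ℂ} (him : ∀ v : ℝ, (f (p + v * Complex.I)).im = 0) {u : ℝ}
    (hu : ¬ FrickeZeros.IsOddZero f (p + u * Complex.I)) :
    (∀ᶠ v : ℝ in 𝓝 u, 0 ≤ (f (p + v * Complex.I)).re) ∨
      ∀ᶠ v : ℝ in 𝓝 u, (f (p + v * Complex.I)).re ≤ 0 := by
  have hline : Continuous fun v : ℝ => p + v * Complex.I := by fun_prop
  have hA : AnalyticAt ℂ f (p + u * Complex.I) := hf.analyticAt _
  have htop : analyticOrderAt f (p + u * Complex.I) ≠ ⊤ := by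
    intro h
    rw [analyticOrderAt_eq_top] at h
    refine hs₁ (eq_zero_of_frequently_eq_zero_line hf (p := p) (u := u) (Eventually.frequently ?_)
      s₁)
    exact ((hline.tendsto u).eventually h).filter_mono nhdsWithin_le_nhds
  obtain ⟨m, hm⟩ := ENat.ne_top_iff_exists.1 htop
  have heven : Even m := by
    by_contra hodd
    exact hu ⟨m, Nat.not_even_iff_odd.1 hodd, hm.symm⟩
  obtain ⟨j, rfl⟩ := heven
  obtain ⟨g, hg, hg0, hfg⟩ := hA.analyticOrderAt_eq_natCast.1 hm.symm
  -- On the line `f = (v - u)^(2j) q(v)`, where `(-1)^j` comes from `i^(2j)`. Then `q(u)` is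
  -- nonzero, and real as a limit of real values, so its sign is the sign of `f` near `u`.
  set q : ℝ → ℂ := fun v => (-1) ^ j * g (p + v * Complex.I) with hq
  have hqc : ContinuousAt q u := by
    refine ContinuousAt.mul continuousAt_const ?_
    exact ContinuousAt.comp (f := fun v : ℝ => p + v * Complex.I) hg.continuousAt
      hline.continuousAt
  have hq0 : q u ≠ 0 := mul_ne_zero (pow_ne_zero _ (by norm_num)) hg0
  have hfq : ∀ᶠ v : ℝ in 𝓝 u, f (p + v * Complex.I) = (((v - u) ^ (j + j) : ℝ) : ℂ) * q v := by
    filter_upwards [(hline.tendsto u).eventually hfg] with v hv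
    rw [hv, smul_eq_mul, hq, show p + v * Complex.I - (p + u * Complex.I) =
      ((v - u : ℝ) : ℂ) * Complex.I by push_cast; ring, mul_pow, ← two_mul, pow_mul Complex.I,
      Complex.I_sq]
    push_cast
    ring
  have hqim : (q u).im = 0 := by
    have h1 : Tendsto (fun v => (q v).im) (𝓝[≠] u) (𝓝 (q u).im) :=
      ((Complex.continuous_im.tendsto _).comp hqc.tendsto).mono_left nhdsWithin_le_nhds
    have h2 : Tendsto (fun v => (q v).im) (𝓝[≠] u) (𝓝 0) := by
      refine tendsto_const_nhds.congr' ?_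
      filter_upwards [hfq.filter_mono nhdsWithin_le_nhds, self_mem_nhdsWithin] with v hv hvu
      have := him v
      rw [hv, im_ofReal_mul] at this
      rcases mul_eq_zero.1 this with h | h
      · exact absurd h (pow_ne_zero _ (sub_ne_zero.2 hvu))
      · exact h.symm
    exact tendsto_nhds_unique h1 h2
  have hqre : (q u).re ≠ 0 := fun h => hq0 (Complex.ext h hqim)
  have hrec : ContinuousAt (fun v => (q v).re) u := Complex.continuous_re.continuousAt.comp hqc
  have hpow (v : ℝ) : 0 ≤ (v - u) ^ (j + j) := Even.pow_nonneg ⟨j, rfl⟩ _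
  rcases lt_or_gt_of_ne hqre with h | h
  · right
    filter_upwards [hfq, hrec.eventually (gt_mem_nhds h)] with v hv hv'
    rw [hv, re_ofReal_mul]
    exact mul_nonpos_of_nonneg_of_nonpos (hpow v) hv'.le
  · left
    filter_upwards [hfq, hrec.eventually (lt_mem_nhds h)] with v hv hv'
    rw [hv, re_ofReal_mul]
    exact mul_nonneg (hpow v) hv'.le

/-- A function that is real on a vertical line has constant sign on each interval of that line
without zeros of odd order. -/
lemma nonneg_or_nonpos_of_forall_not_isOddZero {f : ℂ → ℂ} (hf : Differentiable ℂ f) {s₁ : ℂ}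
    (hs₁ : f s₁ ≠ 0) {p : ℂ} (him : ∀ v : ℝ, (f (p + v * Complex.I)).im = 0) {a b : ℝ}
    (hab : ∀ u ∈ Set.Icc a b, ¬ FrickeZeros.IsOddZero f (p + u * Complex.I)) :
    (∀ u ∈ Set.Icc a b, 0 ≤ (f (p + u * Complex.I)).re) ∨
      ∀ u ∈ Set.Icc a b, (f (p + u * Complex.I)).re ≤ 0 := by
  set P : Set ℝ := {u | ∀ᶠ v : ℝ in 𝓝 u, 0 ≤ (f (p + v * Complex.I)).re} with hP
  set Q : Set ℝ := {u | ∀ᶠ v : ℝ in 𝓝 u, (f (p + v * Complex.I)).re ≤ 0} with hQ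
  have hPo : IsOpen P := isOpen_setOfPred_eventually_nhds
  have hQo : IsOpen Q := isOpen_setOfPred_eventually_nhds
  -- At a common point `f` would vanish on a whole segment, hence everywhere. Thus `P` and `Q` are
  -- disjoint open sets covering a connected interval.
  have hPQ : P ∩ Q = ∅ := by
    refine Set.eq_empty_of_forall_notMem fun u hu => hs₁ ?_
    refine eq_zero_of_frequently_eq_zero_line hf (p := p) (u := u) (Eventually.frequently ?_) s₁
    filter_upwards [hu.1.filter_mono nhdsWithin_le_nhds,
      hu.2.filter_mono nhdsWithin_le_nhds] with v h1 h2
    exact Complex.ext (le_antisymm h2 h1) (him v)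
  have hcov : Set.Icc a b ⊆ P ∪ Q := fun u hu =>
    eventually_nonneg_or_nonpos_of_not_isOddZero hf hs₁ him (hab u hu)
  rcases isPreconnected_iff_subset_of_disjoint.1 isPreconnected_Icc P Q hPo hQo hcov
    (by rw [hPQ, Set.inter_empty]) with h | h
  · exact Or.inl fun u hu => (h hu).self_of_nhds
  · exact Or.inr fun u hu => (h hu).self_of_nhds

/-- Infinitely many zeros in a compact segment would accumulate. Finiteness matters because
`Set.ncard` of an infinite set is `0`. -/
lemma finite_setOf_isOddZero {f : ℂ → ℂ} (hf : Differentiable ℂ f) {s₁ : ℂ} (hs₁ : f s₁ ≠ 0)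
    (p : ℂ) (T : ℝ) :
    {t : ℝ | 0 ≤ t ∧ t ≤ T ∧ FrickeZeros.IsOddZero f (p + t * Complex.I)}.Finite := by
  by_contra hinf
  obtain ⟨u, -, hu⟩ := Set.Infinite.exists_accPt_of_subset_isCompact hinf
    (isCompact_Icc (a := (0 : ℝ)) (b := T)) (fun t ht => ⟨ht.1, ht.2.1⟩)
  refine hs₁ (eq_zero_of_frequently_eq_zero_line hf (p := p) (u := u) ?_ s₁)
  refine (accPt_iff_frequently_nhdsNE.1 hu).mono fun v hv => ?_
  obtain ⟨-, -, m, hm, ho⟩ := hv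
  by_contra h0
  rw [(hf.analyticAt _).analyticOrderAt_eq_zero.2 h0] at ho
  have : m = 0 := by exact_mod_cast ho.symm
  rw [this] at hm
  exact absurd hm (by decide)

end SignChanges

/-! ### Cauchy's theorem on a rectangle -/

section Rectangle

open Complex MeasureTheory

/-- A lower bound for the integral along a vertical segment of an entire function that is close to
a constant on another vertical line. -/
lemma norm_mul_le_integral_add_of_norm_sub_le {f : ℂ → ℂ} (hf : Differentiable ℂ f)
    {α β : ℝ} (hαβ : α ≤ β) {a : ℂ} (ha : ∀ s : ℂ, s.re = β → ‖f s - a‖ ≤ ‖a‖ / 2) (t : ℝ)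
    {H : ℝ} (hH : 0 ≤ H) :
    ‖a‖ / 2 * H ≤ (∫ u in t..(t + H), ‖f (α + u * Complex.I)‖) +
      (∫ σ in α..β, ‖f (σ + t * Complex.I)‖) + ∫ σ in α..β, ‖f (σ + (t + H : ℝ) * Complex.I)‖ := by
  have hfc := hf.continuous
  have hrect := Complex.integral_boundary_rect_eq_zero_of_differentiableOn f
    (α + t * Complex.I) (β + (t + H : ℝ) * Complex.I) hf.differentiableOn
  simp only [add_re, ofReal_re, mul_re, Complex.I_re, mul_zero, ofReal_im, Complex.I_im, mul_one,
    sub_self, add_zero, add_im, mul_im, zero_add, smul_eq_mul] at hrect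
  have ht : t ≤ t + H := by linarith
  set V := ∫ u in t..(t + H), f (β + u * Complex.I)
  set W := ∫ u in t..(t + H), f (α + u * Complex.I)
  set X := ∫ σ in α..β, f (σ + t * Complex.I)
  set Y := ∫ σ in α..β, f (σ + (t + H : ℝ) * Complex.I)
  have hW : ‖W‖ ≤ ∫ u in t..(t + H), ‖f (α + u * Complex.I)‖ :=
    intervalIntegral.norm_integral_le_integral_norm ht
  have hX : ‖X‖ ≤ ∫ σ in α..β, ‖f (σ + t * Complex.I)‖ :=
    intervalIntegral.norm_integral_le_integral_norm hαβ
  have hY : ‖Y‖ ≤ ∫ σ in α..β, ‖f (σ + (t + H : ℝ) * Complex.I)‖ :=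
    intervalIntegral.norm_integral_le_integral_norm hαβ
  have hVa : ‖V - H * a‖ ≤ ‖a‖ / 2 * H := by
    have e : V - H * a = ∫ u in t..(t + H), (f (β + u * Complex.I) - a) := by
      rw [intervalIntegral.integral_sub
        (Continuous.intervalIntegrable (by fun_prop) _ _) (by simp)]
      simp [V]
    rw [e]
    have := intervalIntegral.norm_integral_le_of_norm_le_const (a := t) (b := t + H)
      (f := fun u : ℝ => f (β + u * Complex.I) - a) (C := ‖a‖ / 2) fun u _ => ha _ (by simp)
    simpa [abs_of_nonneg hH] using this
  -- Cauchy's theorem expresses the right side of the rectangle through the other three.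
  have hVn : ‖V‖ = ‖W * Complex.I - X + Y‖ := by
    have : Complex.I * V = W * Complex.I - X + Y := by linear_combination hrect
    rw [← this, norm_mul, Complex.norm_I, one_mul]
  have h1 : ‖V‖ ≤ ‖W‖ + ‖X‖ + ‖Y‖ := by
    rw [hVn]
    refine (norm_add_le _ _).trans ?_
    gcongr
    refine (norm_sub_le _ _).trans ?_
    rw [norm_mul, Complex.norm_I, mul_one]
  have h2 : ‖(H : ℂ) * a‖ = H * ‖a‖ := by
    rw [norm_mul, Complex.norm_real, Real.norm_of_nonneg hH]
  have h3 : ‖(H : ℂ) * a‖ ≤ ‖V‖ + ‖V - H * a‖ := by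
    have := norm_sub_le V (V - H * a)
    simpa using this
  nlinarith

end Rectangle

/-! ### Horizontal segments, and windows without odd zeros -/

namespace FrickeZeros

open Complex Topology MeasureTheory

namespace IsRotatedMellin

variable {F L : ℂ → ℂ} {κ A : ℝ}

lemma continuous_norm_cpow_mul (h : IsRotatedMellin F L κ A) {n₀ : ℕ} (hn₀ : n₀ ≠ 0) :
    Continuous fun p : ℝ × ℝ =>
      ‖(n₀ : ℂ) ^ ((p.1 : ℂ) + p.2 * Complex.I) * L (p.1 + p.2 * Complex.I)‖ := by
  refine (Continuous.mul ?_ (h.differentiable.continuous.comp (by fun_prop))).norm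
  exact Continuous.const_cpow (by fun_prop) (Or.inl (by exact_mod_cast hn₀))

/-- Passing from the second moment to the first halves the exponent of the singularity at the
critical line, which becomes integrable in `σ`. The passage uses `|L| ≤ r/2 + |L|²/(2r)` with the
balancing value `r = (σ - κ/2)^(-1/2)`. -/
lemma exists_integral_norm_le (h : IsRotatedMellin F L κ A) (σ₁ : ℝ) {n₀ : ℕ} (hn₀ : n₀ ≠ 0) :
    ∃ B : ℝ, 0 < B ∧ ∀ T : ℝ, 1 ≤ T → ∀ σ ∈ Set.Ioo (κ / 2) σ₁,
      ∫ t in T..(3 * T), ‖(n₀ : ℂ) ^ ((σ : ℂ) + t * Complex.I) * L (σ + t * Complex.I)‖ ≤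
        B * T * (σ - κ / 2) ^ (-(1 / 2) : ℝ) := by
  obtain ⟨B, hB0, hB⟩ := h.exists_integral_norm_sq_L_le σ₁
  have hn₀1 : (1 : ℝ) ≤ n₀ := by exact_mod_cast Nat.one_le_iff_ne_zero.2 hn₀
  have hn₀0 : (0 : ℝ) < n₀ := by linarith
  refine ⟨(n₀ : ℝ) ^ σ₁ * (1 + B / 2), by positivity, fun T hT σ hσ => ?_⟩
  have hd : 0 < σ - κ / 2 := by linarith [hσ.1]
  obtain ⟨r, hr⟩ : ∃ r, r = (σ - κ / 2) ^ (-(1 / 2) : ℝ) := ⟨_, rfl⟩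
  rw [← hr]
  have hr0 : 0 < r := by rw [hr]; positivity
  have hrr : r * r = (σ - κ / 2)⁻¹ := by
    rw [hr, ← Real.rpow_add hd, ← Real.rpow_neg_one]; norm_num
  have hc1 : Continuous fun t : ℝ => ‖L (σ + t * Complex.I)‖ :=
    (h.differentiable.continuous.comp (by fun_prop)).norm
  have hc2 : Continuous fun t : ℝ => ‖(n₀ : ℂ) ^ ((σ : ℂ) + t * Complex.I) *
      L (σ + t * Complex.I)‖ := by
    have := (h.continuous_norm_cpow_mul hn₀).comp (Continuous.prodMk_right σ)
    exact this
  have hc3 : Continuous fun t : ℝ => ‖L (σ + t * Complex.I)‖ ^ 2 / (2 * r) :=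
    (hc1.pow 2).div_const _
  have hT3 : T ≤ 3 * T := by linarith
  have hle : ∫ t in T..(3 * T), ‖(n₀ : ℂ) ^ ((σ : ℂ) + t * Complex.I) *
      L (σ + t * Complex.I)‖ ≤ ∫ t in T..(3 * T), (n₀ : ℝ) ^ σ₁ *
        (r / 2 + ‖L (σ + t * Complex.I)‖ ^ 2 / (2 * r)) := by
    refine intervalIntegral.integral_mono_on hT3 (hc2.intervalIntegrable _ _)
      (((hc3.const_add _).const_mul _).intervalIntegrable _ _) fun t _ => ?_
    rw [norm_mul, ← ofReal_natCast, norm_cpow_eq_rpow_re_of_pos hn₀0]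
    have h1 : (n₀ : ℝ) ^ ((σ : ℂ) + t * Complex.I).re ≤ (n₀ : ℝ) ^ σ₁ := by
      refine Real.rpow_le_rpow_of_exponent_le hn₀1 ?_
      simpa using hσ.2.le
    have h2 : ‖L (σ + t * Complex.I)‖ ≤ r / 2 + ‖L (σ + t * Complex.I)‖ ^ 2 / (2 * r) := by
      rw [div_add_div _ _ two_ne_zero (by positivity), le_div_iff₀ (by positivity)]
      nlinarith [sq_nonneg (r - ‖L (σ + t * Complex.I)‖)]
    gcongr
  refine hle.trans ?_
  rw [intervalIntegral.integral_const_mul, intervalIntegral.integral_add (by simp)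
    (hc3.intervalIntegrable _ _), intervalIntegral.integral_const,
    smul_eq_mul, intervalIntegral.integral_div]
  have h3 := hB T σ hT hσ.1 hσ.2.le
  have h4 : (∫ t in T..(3 * T), ‖L (σ + t * Complex.I)‖ ^ 2) / (2 * r) ≤ B / 2 * T * r := by
    rw [div_le_iff₀ (by positivity)]
    refine h3.trans (le_of_eq ?_)
    rw [div_eq_mul_inv, ← hrr]
    ring
  calc (n₀ : ℝ) ^ σ₁ * ((3 * T - T) * (r / 2) +
        (∫ t in T..(3 * T), ‖L (σ + t * Complex.I)‖ ^ 2) / (2 * r))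
      ≤ (n₀ : ℝ) ^ σ₁ * ((3 * T - T) * (r / 2) + B / 2 * T * r) := by gcongr
    _ = _ := by ring

/-- The mean over `t` of the integral of `n₀^s L(s)` over horizontal segments to the right of the
critical line is bounded. -/
lemma exists_integral_integral_norm_le (h : IsRotatedMellin F L κ A) {σ₁ : ℝ} (hσ₁ : κ / 2 ≤ σ₁)
    {n₀ : ℕ} (hn₀ : n₀ ≠ 0) : ∃ B : ℝ, 0 < B ∧ ∀ T : ℝ, 1 ≤ T →
      ∫ t in T..(3 * T), ∫ σ in (κ / 2)..σ₁,
        ‖(n₀ : ℂ) ^ ((σ : ℂ) + t * Complex.I) * L (σ + t * Complex.I)‖ ≤ B * T := by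
  obtain ⟨B, hB0, hB⟩ := h.exists_integral_norm_le σ₁ hn₀
  -- The rest is Fubini and the integral of `(σ - κ/2)^(-1/2)`, for which continuity of the
  -- integrand is enough.
  suffices ∀ g : ℝ → ℝ → ℝ, Continuous (Function.uncurry g) →
      (∀ T : ℝ, 1 ≤ T → ∀ σ ∈ Set.Ioo (κ / 2) σ₁,
        ∫ t in T..(3 * T), g σ t ≤ B * T * (σ - κ / 2) ^ (-(1 / 2) : ℝ)) →
      ∃ B : ℝ, 0 < B ∧ ∀ T : ℝ, 1 ≤ T →
        ∫ t in T..(3 * T), ∫ σ in (κ / 2)..σ₁, g σ t ≤ B * T from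
    this (fun σ t => ‖(n₀ : ℂ) ^ ((σ : ℂ) + t * Complex.I) * L (σ + t * Complex.I)‖)
      (h.continuous_norm_cpow_mul hn₀) hB
  clear hB
  intro g hg hB
  set J := ∫ σ in (κ / 2)..σ₁, (σ - κ / 2) ^ (-(1 / 2) : ℝ) with hJ
  have hJ0 : 0 ≤ J := intervalIntegral.integral_nonneg hσ₁ fun σ hσ =>
    Real.rpow_nonneg (by linarith [hσ.1]) _
  refine ⟨B * J + 1, by positivity, fun T hT => ?_⟩
  have hswap : ∫ t in T..(3 * T), ∫ σ in (κ / 2)..σ₁, g σ t =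
      ∫ σ in (κ / 2)..σ₁, ∫ t in T..(3 * T), g σ t :=
    intervalIntegral_intervalIntegral_swap
      (((hg.comp continuous_swap).continuousOn.integrableOn_compact
      (isCompact_uIcc.prod isCompact_uIcc)).mono_set
      (Set.prod_mono Set.uIoc_subset_uIcc Set.uIoc_subset_uIcc))
  have hi1 : IntervalIntegrable (fun σ => ∫ t in T..(3 * T), g σ t) volume (κ / 2) σ₁ :=
    (intervalIntegral.continuous_parametric_intervalIntegral_of_continuous' hg T
      (3 * T)).intervalIntegrable _ _
  have hi2 : IntervalIntegrable (fun σ : ℝ => B * T * (σ - κ / 2) ^ (-(1 / 2) : ℝ)) volume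
      (κ / 2) σ₁ := by
    refine IntervalIntegrable.const_mul ?_ _
    have := (intervalIntegral.intervalIntegrable_rpow' (a := 0) (b := σ₁ - κ / 2)
      (r := -(1 / 2)) (by norm_num)).comp_sub_right (κ / 2)
    simpa using this
  rw [hswap]
  -- The open interval matters: at `σ = κ/2` the majorant is `0 ^ (-1/2) = 0` by convention.
  refine (intervalIntegral.integral_mono_on_of_le_Ioo hσ₁ hi1 hi2 (hB T hT)).trans ?_
  rw [intervalIntegral.integral_const_mul, ← hJ, add_mul, one_mul]
  have e : B * T * J = B * J * T := by ring
  linarith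

lemma exists_mellin_ne_zero (h : IsRotatedMellin F L κ A) :
    ∃ s, mellin (fun y : ℝ => F y) s ≠ 0 := by
  obtain ⟨σ₁, n₀, a, hσ₁, -, ha, hb⟩ := h.first_term
  have hre : 0 < ((σ₁ : ℝ) : ℂ).re := by rw [ofReal_re]; linarith [h.kappa_pos]
  have hL : L σ₁ ≠ 0 := by
    intro h0
    have := hb σ₁ (by simp)
    rw [h0, mul_zero, zero_sub, norm_neg] at this
    linarith [norm_pos_iff.2 ha]
  refine ⟨σ₁, ?_⟩
  have h1 := h.mellin_eq_of_re_pos (w := 1) (by simp) hre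
  simp only [one_mul] at h1
  rw [h1]
  have hA0 : (A : ℂ) ≠ 0 := by exact_mod_cast h.pos.ne'
  refine mul_ne_zero (mul_ne_zero (mul_ne_zero ?_ ?_) (Gamma_ne_zero_of_re_pos hre)) hL
  · simp
  · rw [Ne, cpow_eq_zero_iff]
    exact fun h => hA0 h.1

lemma exists_L_ne_zero (h : IsRotatedMellin F L κ A) : ∃ s, L s ≠ 0 := by
  obtain ⟨σ₁, n₀, a, hσ₁, -, ha, hb⟩ := h.first_term
  refine ⟨σ₁, fun h0 => ?_⟩
  have := hb σ₁ (by simp)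
  rw [h0, mul_zero, zero_sub, norm_neg] at this
  linarith [norm_pos_iff.2 ha]

/-- The factor `c A^s Γ(s)` is analytic and zero-free on `Re s > 0`, so it does not change orders.
-/
lemma isOddZero_mellin_iff (h : IsRotatedMellin F L κ A) {c : ℂ} (hc : c ≠ 0) {s : ℂ}
    (hs : 0 < s.re) :
    IsOddZero (fun s => c * mellin (fun y : ℝ => F y) s) s ↔ IsOddZero L s := by
  have hA0 : (A : ℂ) ≠ 0 := by exact_mod_cast h.pos.ne'
  have hopen : IsOpen {z : ℂ | 0 < z.re} := isOpen_lt continuous_const Complex.continuous_re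
  have hev : (fun s => c * mellin (fun y : ℝ => F y) s) =ᶠ[𝓝 s]
      (fun s => c * (A : ℂ) ^ s * Complex.Gamma s) * L := by
    filter_upwards [hopen.mem_nhds hs] with z hz
    have h1 := h.mellin_eq_of_re_pos (w := 1) (by simp) hz
    simp only [one_mul] at h1
    rw [h1, Pi.mul_apply]
    simp
    ring
  have hA1 : AnalyticAt ℂ (fun s => c * (A : ℂ) ^ s * Complex.Gamma s) s := by
    refine DifferentiableOn.analyticAt (s := {z : ℂ | 0 < z.re}) (fun z (hz : 0 < z.re) => ?_)
      (hopen.mem_nhds hs)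
    refine DifferentiableAt.differentiableWithinAt ?_
    refine (DifferentiableAt.const_mul (differentiableAt_id.const_cpow (Or.inl hA0)) c).mul ?_
    refine differentiableAt_Gamma _ fun m hm => ?_
    rw [hm] at hz
    simp at hz
    linarith [(m.cast_nonneg : (0 : ℝ) ≤ m)]
  have hne : c * (A : ℂ) ^ s * Complex.Gamma s ≠ 0 := by
    refine mul_ne_zero (mul_ne_zero hc ?_) (Gamma_ne_zero_of_re_pos hs)
    rw [Ne, cpow_eq_zero_iff]
    exact fun h => hA0 h.1
  have : analyticOrderAt (fun s => c * mellin (fun y : ℝ => F y) s) s = analyticOrderAt L s := by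
    rw [analyticOrderAt_congr hev, analyticOrderAt_mul hA1 (h.differentiable.analyticAt s),
      hA1.analyticOrderAt_eq_zero.2 hne, zero_add]
  rw [IsOddZero, IsOddZero, this]

/-- If `L` has no zero of odd order on a segment of the critical line, there is no cancellation in
the integral of the completed `L`-function over that segment. -/
lemma integral_norm_eq_norm_integral (h : IsRotatedMellin F L κ A) {T : ℝ} (hT : 1 ≤ T) {t H : ℝ}
    (hH : 0 ≤ H) (hodd : ∀ u ∈ Set.Icc t (t + H), ¬ IsOddZero L ((κ / 2 : ℝ) + u * Complex.I)) :
    ∫ v in (0 : ℝ)..H, ‖mellin (fun y : ℝ => F (tilt T * y))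
        ((κ / 2 : ℝ) + (t + v : ℝ) * Complex.I)‖ =
      ‖∫ v in (0 : ℝ)..H, mellin (fun y : ℝ => F (tilt T * y))
        ((κ / 2 : ℝ) + (t + v : ℝ) * Complex.I)‖ := by
  obtain ⟨c, hc, him⟩ := h.exists_im_eq_zero
  have hκ := h.kappa_pos
  have hre (u : ℝ) : 0 < (((κ / 2 : ℝ) : ℂ) + u * Complex.I).re := by
    simpa using hκ
  set f : ℂ → ℂ := fun s => c * mellin (fun y : ℝ => F y) s with hf
  have hfd : Differentiable ℂ f := by
    have := h.differentiable_mellin (w := 1) (by simp)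
    simp only [one_mul] at this
    exact this.const_mul c
  obtain ⟨s₁, hs₁⟩ := h.exists_mellin_ne_zero
  have hsign := nonneg_or_nonpos_of_forall_not_isOddZero hfd (mul_ne_zero hc hs₁) him
    (a := t) (b := t + H) fun u hu => by
      rw [h.isOddZero_mellin_iff hc (hre u)]
      exact hodd u hu
  set θ : ℝ := Real.pi / 2 - 1 / T with hθ
  set b : ℂ := c⁻¹ * (1 / tilt T) ^ ((κ / 2 : ℝ) : ℂ) with hb
  have htilt : tilt T ≠ 0 := Complex.exp_ne_zero _
  have hcpow (u : ℝ) : (1 / tilt T) ^ ((u : ℂ) * Complex.I) = ((Real.exp (θ * u) : ℝ) : ℂ) := by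
    have hT' : 0 < 1 / T := by positivity
    have hT'' : 1 / T ≤ 1 := by rw [div_le_one (by linarith)]; exact hT
    have hpi := Real.pi_gt_three
    have h0 : 1 / tilt T = Complex.exp ((-θ : ℝ) * Complex.I) := by
      rw [tilt, one_div, ← Complex.exp_neg, hθ]
      push_cast
      ring_nf
    have him' : (((-θ : ℝ) : ℂ) * Complex.I).im = -θ := by rw [mul_I_im, ofReal_re]
    rw [h0, cpow_def_of_ne_zero (Complex.exp_ne_zero _), Complex.log_exp (by rw [him']; linarith)
      (by rw [him']; linarith), ofReal_exp]
    congr 1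
    push_cast
    linear_combination (-(θ : ℂ) * u) * Complex.I_sq
  -- Along the critical line the rotation contributes a fixed constant and the positive factor
  -- `e^(θu)`, so the rotated transform is the constant `b` times a real function with the signs of
  -- `f`.
  have hval (u : ℝ) : mellin (fun y : ℝ => F (tilt T * y)) ((κ / 2 : ℝ) + u * Complex.I) =
      b * ((Real.exp (θ * u) * (f ((κ / 2 : ℝ) + u * Complex.I)).re : ℝ) : ℂ) := by
    have h1 := h.mellin_eq_of_re_pos (w := 1) (by simp) (hre u)
    simp only [one_mul] at h1
    have h2 : (((f ((κ / 2 : ℝ) + u * Complex.I)).re : ℝ) : ℂ) = f ((κ / 2 : ℝ) + u * Complex.I) :=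
      Complex.ext (by simp) (by rw [ofReal_im]; exact (him u).symm)
    rw [h.mellin_eq_of_re_pos (tilt_re_pos hT) (hre u), ofReal_mul, h2, hf]
    simp only
    rw [h1, cpow_add _ _ (one_div_ne_zero htilt), hcpow, hb]
    field_simp
    simp
  have hmem {v : ℝ} (hv : v ∈ Set.Icc 0 H) : t + v ∈ Set.Icc t (t + H) :=
    ⟨by linarith [hv.1], by linarith [hv.2]⟩
  simp only [hval]
  rw [intervalIntegral.integral_const_mul, intervalIntegral.integral_ofReal, norm_mul]
  simp only [norm_mul b]
  rw [intervalIntegral.integral_const_mul, Complex.norm_real]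
  congr 1
  simp only [Complex.norm_real]
  rcases hsign with hs | hs
  · rw [Real.norm_of_nonneg]
    · refine intervalIntegral.integral_congr fun v hv => ?_
      rw [Set.uIcc_of_le hH] at hv
      exact Real.norm_of_nonneg (mul_nonneg (Real.exp_pos _).le (hs _ (hmem hv)))
    · exact intervalIntegral.integral_nonneg hH fun v hv =>
        mul_nonneg (Real.exp_pos _).le (hs _ (hmem hv))
  · rw [Real.norm_of_nonpos, ← intervalIntegral.integral_neg]
    · refine intervalIntegral.integral_congr fun v hv => ?_
      rw [Set.uIcc_of_le hH] at hv
      exact Real.norm_of_nonpos (mul_nonpos_of_nonneg_of_nonpos (Real.exp_pos _).le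
        (hs _ (hmem hv)))
    · rw [← neg_nonneg, ← intervalIntegral.integral_neg]
      exact intervalIntegral.integral_nonneg hH fun v hv => neg_nonneg.2
        (mul_nonpos_of_nonneg_of_nonpos (Real.exp_pos _).le (hs _ (hmem hv)))

end IsRotatedMellin

end FrickeZeros

/-! ### The counting argument -/

open MeasureTheory in
/-- If a function is at least `1` wherever a window of length `H` contains no point of `Z`, and
its integral is at most half of the length of the interval, then `Z` is not sparse. -/
lemma half_le_mul_ncard_of_integral_le {Z : Set ℝ} (hZ : Z.Finite) {T H : ℝ} (hT : 0 ≤ T)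
    (hH : 0 ≤ H) {g : ℝ → ℝ} (hg : ∀ t, 0 ≤ g t) (hgi : IntegrableOn g (Set.Ioc T (2 * T)))
    (hint : ∫ t in T..(2 * T), g t ≤ T / 2)
    (h : ∀ t ∈ Set.Ioc T (2 * T), (∀ u ∈ Set.Icc t (t + H), u ∉ Z) → 1 ≤ g t) :
    T / 2 ≤ H * Z.ncard := by
  have hT2 : T ≤ 2 * T := by linarith
  rw [intervalIntegral.integral_of_le hT2] at hint
  -- Markov's inequality bounds the starting points of windows free of `Z`; a window that contains
  -- `z ∈ Z` starts in `[z - H, z]`.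
  have hmarkov : volume.real ({t | 1 ≤ g t} ∩ Set.Ioc T (2 * T)) ≤ T / 2 := by
    have h1 := mul_meas_ge_le_integral_of_nonneg (μ := volume.restrict (Set.Ioc T (2 * T)))
      (Eventually.of_forall hg) hgi 1
    rw [one_mul, measureReal_restrict_apply' measurableSet_Ioc] at h1
    exact h1.trans hint
  have hU : volume.real (⋃ z ∈ hZ.toFinset, Set.Icc (z - H) z) ≤ H * Z.ncard := by
    refine (measureReal_biUnion_finset_le _ _).trans ?_
    simp only [Real.volume_real_Icc, sub_sub_cancel, max_eq_left hH, Finset.sum_const,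
      nsmul_eq_mul, Set.ncard_eq_toFinset_card Z hZ]
    rw [mul_comm]
  have hsub : Set.Ioc T (2 * T) ⊆ ({t | 1 ≤ g t} ∩ Set.Ioc T (2 * T)) ∪
      ⋃ z ∈ hZ.toFinset, Set.Icc (z - H) z := by
    intro t ht
    by_cases hz : ∀ u ∈ Set.Icc t (t + H), u ∉ Z
    · exact Or.inl ⟨h t ht hz, ht⟩
    · push Not at hz
      obtain ⟨u, hu, huZ⟩ := hz
      refine Or.inr (Set.mem_biUnion (hZ.mem_toFinset.2 huZ) ⟨?_, hu.1⟩)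
      linarith [hu.2]
  have hfin : volume (({t | 1 ≤ g t} ∩ Set.Ioc T (2 * T)) ∪
      ⋃ z ∈ hZ.toFinset, Set.Icc (z - H) z) ≠ ⊤ := by
    refine (measure_union_lt_top ((measure_mono Set.inter_subset_right).trans_lt ?_) ?_).ne
    · simp
    · refine (measure_biUnion_finset_le _ _).trans_lt (ENNReal.sum_lt_top.2 fun z _ => ?_)
      simp
  have hvol := (measureReal_mono hsub hfin).trans (measureReal_union_le _ _)
  rw [Real.volume_real_Ioc_of_le hT2] at hvol
  linarith

open MeasureTheory in
/-- The counting argument of Hardy and Littlewood: if windows of length `H` without points of `P`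
force a lower bound for a quantity that is small in mean, then `P` has positive lower density. -/
lemma exists_half_le_mul_ncard {P : ℝ → Prop} {J : ℝ → ℝ → ℝ → ℝ} {X : ℝ → ℝ} {a B C D κ : ℝ}
    (hP : ∀ T : ℝ, {t | 0 ≤ t ∧ t ≤ T ∧ P t}.Finite) (ha : 0 < a) (hC : 0 < C)
    (hD : 0 < D) (hI : ∀ T H : ℝ, 1 ≤ T → 0 < H → Integrable (fun t => J T H t ^ 2) ∧
      ∫ t, J T H t ^ 2 ≤ B * H * T ^ κ)
    (hX0 : ∀ t, 0 ≤ X t) (hXc : Continuous X)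
    (hXint : ∀ T : ℝ, 1 ≤ T → ∫ t in T..(3 * T), X t ≤ C * T)
    (hpt : ∀ T t H : ℝ, 1 ≤ T → 0 ≤ H → T ≤ t → t + H ≤ 3 * T →
      (∀ u ∈ Set.Icc t (t + H), ¬ P u) →
      a / 2 * H ≤ D * T ^ (-((κ - 1) / 2)) * J T H t + X t + X (t + H)) :
    ∃ H : ℝ, 1 ≤ H ∧ ∀ T : ℝ, H ≤ T →
      T / 2 ≤ H * {t | 0 ≤ t ∧ t ≤ 2 * T + H ∧ P t}.ncard := by
  set K := (1 + D ^ 2 * B) / 2 with hK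
  -- With `H = q²`, the window integral contributes about `√H = q` on average and the horizontal
  -- sides contribute `2C`, against a main term proportional to `a q²`. This `q` gives `4(qK + 2C) ≤
  -- a q²`, which is what makes the mean at most `1/2`.
  set q := max 1 (4 * (K + 2 * C) / a) with hq
  have hq1 : 1 ≤ q := le_max_left _ _
  have hq0 : 0 < q := by linarith
  have hqa : 4 * (K + 2 * C) ≤ q * a := by
    rw [← div_le_iff₀ ha]
    exact le_max_right _ _
  set H := q ^ 2 with hH
  have hH1 : 1 ≤ H := one_le_pow₀ hq1
  refine ⟨H, hH1, fun T hT => ?_⟩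
  have hT1 : 1 ≤ T := hH1.trans hT
  have hT0 : 0 < T := by linarith
  obtain ⟨hIi, hIle⟩ := hI T H hT1 (by linarith)
  have hXT : ∫ t in T..(3 * T), X t ≤ C * T := hXint T hT1
  have hXsub {u v : ℝ} (hu : T ≤ u) (huv : u ≤ v) (hv : v ≤ 3 * T) :
      ∫ t in u..v, X t ≤ C * T :=
    (intervalIntegral.integral_mono_interval hu huv hv (Eventually.of_forall hX0)
      (hXc.intervalIntegrable _ _)).trans hXT
  set E := D ^ 2 * T ^ (-(κ - 1)) with hE
  have hE0 : 0 < E := by positivity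
  have hEB : E * (B * H * T ^ κ) = D ^ 2 * B * q ^ 2 * T := by
    have : T ^ (-(κ - 1)) * T ^ κ = T := by
      rw [← Real.rpow_add hT0]
      ring_nf
      exact Real.rpow_one T
    rw [hE, hH]
    linear_combination (D ^ 2 * B * q ^ 2) * this
  have hJ2 : IntervalIntegrable (fun t => J T H t ^ 2) volume T (2 * T) := hIi.intervalIntegrable
  have hJle : ∫ t in T..(2 * T), J T H t ^ 2 ≤ B * H * T ^ κ := by
    rw [intervalIntegral.integral_of_le (by linarith)]
    exact (setIntegral_le_integral hIi (Eventually.of_forall fun _ => sq_nonneg _)).trans hIle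
  have hXi : IntervalIntegrable X volume T (2 * T) := hXc.intervalIntegrable _ _
  have hXHi : IntervalIntegrable (fun t => X (t + H)) volume T (2 * T) :=
    Continuous.intervalIntegrable (by fun_prop) _ _
  have hci : IntervalIntegrable (fun t => E * J T H t ^ 2 / (2 * q)) volume T (2 * T) :=
    (hJ2.const_mul E).div_const _
  have hi₁ : IntervalIntegrable (fun t => q / 2 + E * J T H t ^ 2 / (2 * q)) volume T (2 * T) :=
    intervalIntegrable_const.add hci
  have hi₂ : IntervalIntegrable (fun t => q / 2 + E * J T H t ^ 2 / (2 * q) + X t) volume T (2 * T) :=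
    hi₁.add hXi
  have hgi : IntervalIntegrable
      (fun t => 2 / (a * H) * (q / 2 + E * J T H t ^ 2 / (2 * q) + X t + X (t + H)))
      volume T (2 * T) := (hi₂.add hXHi).const_mul _
  refine half_le_mul_ncard_of_integral_le
    (hP (2 * T + H)) hT0.le (by linarith)
    (g := fun t => 2 / (a * H) * (q / 2 + E * J T H t ^ 2 / (2 * q) + X t + X (t + H)))
    (fun t => ?_) ((intervalIntegrable_iff_integrableOn_Ioc_of_le (by linarith)).1 hgi) ?_
    fun t ht hZ => ?_
  · have := hX0 t
    have := hX0 (t + H)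
    positivity
  · rw [intervalIntegral.integral_const_mul, intervalIntegral.integral_add hi₂ hXHi,
      intervalIntegral.integral_add hi₁ hXi, intervalIntegral.integral_add
      intervalIntegrable_const hci, intervalIntegral.integral_const,
      intervalIntegral.integral_div, intervalIntegral.integral_const_mul,
      intervalIntegral.integral_comp_add_right X H, smul_eq_mul]
    have h1 := hXsub (u := T) (v := 2 * T) le_rfl (by linarith) (by linarith)
    have h2 := hXsub (u := T + H) (v := 2 * T + H) (by linarith) (by linarith) (by linarith)
    have h3 : E * (∫ t in T..(2 * T), J T H t ^ 2) / (2 * q) ≤ D ^ 2 * B * q / 2 * T := by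
      rw [div_le_iff₀ (by positivity)]
      refine (mul_le_mul_of_nonneg_left hJle hE0.le).trans (le_of_eq ?_)
      rw [hEB]
      ring
    rw [div_mul_eq_mul_div, div_le_iff₀ (by positivity)]
    have h4 : q * K + 2 * C ≤ q * (K + 2 * C) := by nlinarith
    have h5 : 4 * (q * K + 2 * C) ≤ a * H := by
      rw [hH]
      nlinarith
    have h6 : T * (4 * (q * K + 2 * C)) ≤ T * (a * H) := by gcongr
    rw [hK] at h6
    linarith
  · have hodd (u : ℝ) (hu : u ∈ Set.Icc t (t + H)) :
        ¬ P u := fun ho =>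
      hZ u hu ⟨by linarith [hu.1, ht.1], by linarith [hu.2, ht.2], ho⟩
    have h1 := hpt T t H hT1 (by linarith) ht.1.le (by linarith [ht.2]) hodd
    rw [div_mul_eq_mul_div, le_div_iff₀ (by positivity)]
    have hsq : (D * T ^ (-((κ - 1) / 2)) * J T H t) ^ 2 = E * J T H t ^ 2 := by
      have : T ^ (-((κ - 1) / 2)) * T ^ (-((κ - 1) / 2)) = T ^ (-(κ - 1)) := by
        rw [← Real.rpow_add hT0]
        ring_nf
      rw [hE]
      linear_combination (D ^ 2 * J T H t ^ 2) * this
    -- AM-GM with parameter `q` replaces the first power of `J` by its square, the only moment that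
    -- is controlled.
    have h2 : D * T ^ (-((κ - 1) / 2)) * J T H t ≤ q / 2 + E * J T H t ^ 2 / (2 * q) := by
      rw [← hsq, div_add_div _ _ two_ne_zero (by positivity), le_div_iff₀ (by positivity)]
      nlinarith [sq_nonneg (q - D * T ^ (-((κ - 1) / 2)) * J T H t)]
    linarith

/-! ### Conclusion -/

namespace FrickeZeros

open Complex Topology MeasureTheory

namespace IsRotatedMellin

variable {F L : ℂ → ℂ} {κ A : ℝ}

lemma continuous_mellin_line (h : IsRotatedMellin F L κ A) {T : ℝ} (hT : 1 ≤ T) (σ : ℝ) :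
    Continuous fun u : ℝ => mellin (fun y : ℝ => F (tilt T * y)) ((σ : ℂ) + u * Complex.I) :=
  (h.differentiable_mellin (tilt_re_pos hT)).continuous.comp (by fun_prop)

/-- A segment of the critical line without zeros of odd order makes the integral of the completed
`L`-function over it large. -/
lemma exists_norm_mul_le_norm_integral_add (h : IsRotatedMellin F L κ A) {σ₁ : ℝ}
    (hσ₁ : κ / 2 ≤ σ₁) {n₀ : ℕ} (hn₀ : n₀ ≠ 0) {a : ℂ}
    (ha : ∀ s : ℂ, s.re = σ₁ → ‖(n₀ : ℂ) ^ s * L s - a‖ ≤ ‖a‖ / 2) :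
    ∃ D : ℝ, 0 < D ∧ ∀ T t H : ℝ, 1 ≤ T → 0 ≤ H → T ≤ t → t + H ≤ 3 * T →
      (∀ u ∈ Set.Icc t (t + H), ¬ IsOddZero L ((κ / 2 : ℝ) + u * Complex.I)) →
      ‖a‖ / 2 * H ≤ D * T ^ (-((κ - 1) / 2)) * ‖∫ v in (0 : ℝ)..H,
          mellin (fun y : ℝ => F (tilt T * y)) ((κ / 2 : ℝ) + (t + v : ℝ) * Complex.I)‖ +
        (∫ σ in (κ / 2)..σ₁, ‖(n₀ : ℂ) ^ ((σ : ℂ) + t * Complex.I) * L (σ + t * Complex.I)‖) +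
        ∫ σ in (κ / 2)..σ₁, ‖(n₀ : ℂ) ^ ((σ : ℂ) + (t + H : ℝ) * Complex.I) *
          L (σ + (t + H : ℝ) * Complex.I)‖ := by
  obtain ⟨c, hc, hcL⟩ := h.exists_norm_L_le
  have hA := h.pos
  have hn₀0 : (0 : ℝ) < n₀ := by exact_mod_cast Nat.pos_of_ne_zero hn₀
  have hn₀c : (n₀ : ℂ) ≠ 0 := by exact_mod_cast hn₀
  refine ⟨(n₀ : ℝ) ^ (κ / 2) / (c * A ^ (κ / 2)), by positivity,
    fun T t H hT hH hTt htH hodd => ?_⟩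
  have hT0 : 0 < T := by linarith
  have hf : Differentiable ℂ fun s => (n₀ : ℂ) ^ s * L s :=
    (differentiable_id.const_cpow (Or.inl hn₀c)).mul h.differentiable
  refine (norm_mul_le_integral_add_of_norm_sub_le hf hσ₁ ha t hH).trans ?_
  gcongr ?_ + _ + _
  -- Only here does the absence of odd zeros enter: the integral has no cancellation, so the bound
  -- on `L` can be applied pointwise under it.
  rw [← h.integral_norm_eq_norm_integral hT hH hodd]
  have hsub := intervalIntegral.integral_comp_add_left (a := 0) (b := H) (fun u : ℝ =>
    ‖mellin (fun y : ℝ => F (tilt T * y)) ((κ / 2 : ℝ) + u * Complex.I)‖) t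
  rw [add_zero] at hsub
  rw [hsub, ← intervalIntegral.integral_const_mul]
  have hc1 := (hf.continuous.comp (by fun_prop : Continuous fun u : ℝ =>
    ((κ / 2 : ℝ) : ℂ) + u * Complex.I)).norm
  refine intervalIntegral.integral_mono_on (by linarith) (hc1.intervalIntegrable _ _)
    (((h.continuous_mellin_line hT (κ / 2)).norm.const_mul _).intervalIntegrable _ _)
    fun u hu => ?_
  have h1 := hcL T (κ / 2) u hT (by linarith [h.one_le]) (hTt.trans hu.1) (hu.2.trans htH)
  rw [norm_mul, ← ofReal_natCast, norm_cpow_eq_rpow_re_of_pos hn₀0]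
  have hre : (((κ / 2 : ℝ) : ℂ) + u * Complex.I).re = κ / 2 := by simp
  rw [hre, div_mul_eq_mul_div, div_mul_eq_mul_div, le_div_iff₀ (by positivity), mul_assoc,
    mul_assoc]
  refine mul_le_mul_of_nonneg_left ?_ (by positivity)
  have hTT : T ^ (-((κ - 1) / 2)) * T ^ (κ / 2 - 1 / 2) = 1 := by
    rw [← Real.rpow_add hT0]
    ring_nf
    exact Real.rpow_zero T
  calc ‖L (((κ / 2 : ℝ) : ℂ) + u * Complex.I)‖ * (c * A ^ (κ / 2))
      = T ^ (-((κ - 1) / 2)) * (c * A ^ (κ / 2) * T ^ (κ / 2 - 1 / 2) *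
          ‖L (((κ / 2 : ℝ) : ℂ) + u * Complex.I)‖) := by
        linear_combination
          (-(‖L (((κ / 2 : ℝ) : ℂ) + u * Complex.I)‖ * (c * A ^ (κ / 2)))) * hTT
    _ ≤ _ := mul_le_mul_of_nonneg_left h1 (by positivity)

lemma exists_half_le_mul_oddZeroCount (h : IsRotatedMellin F L κ A) :
    ∃ H : ℝ, 1 ≤ H ∧ ∀ T : ℝ, H ≤ T → T / 2 ≤ H * oddZeroCount L (κ / 2) (2 * T + H) := by
  obtain ⟨σ₁, n₀, a, hσ₁, hn₀, ha0, ha⟩ := h.first_term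
  obtain ⟨D, hD, hpt⟩ := h.exists_norm_mul_le_norm_integral_add hσ₁.le hn₀ ha
  obtain ⟨B, -, hI⟩ := h.exists_integral_norm_sq_integral_le
  obtain ⟨C, hC, hXint⟩ := h.exists_integral_integral_norm_le hσ₁.le hn₀
  obtain ⟨s₁, hs₁⟩ := h.exists_L_ne_zero
  have hcont : Continuous (Function.uncurry fun t σ : ℝ =>
      ‖(n₀ : ℂ) ^ ((σ : ℂ) + t * Complex.I) * L (σ + t * Complex.I)‖) := by
    have := (h.continuous_norm_cpow_mul hn₀).comp continuous_swap
    exact this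
  exact exists_half_le_mul_ncard
    (finite_setOf_isOddZero h.differentiable hs₁ ((κ / 2 : ℝ) : ℂ)) (norm_pos_iff.2 ha0) hC hD hI
    (fun t => intervalIntegral.integral_nonneg hσ₁.le fun _ _ => norm_nonneg _)
    (intervalIntegral.continuous_parametric_intervalIntegral_of_continuous' hcont _ _) hXint hpt

/-- A positive proportion, in the sense of Hardy and Littlewood, of zeros on the critical line. -/
theorem exists_lt_liminf_oddZeroCount (h : IsRotatedMellin F L κ A) :
    ∃ d : ℝ, 0 < d ∧ (d : EReal) <
      liminf (fun T : ℝ => ((oddZeroCount L (κ / 2) T / T : ℝ) : EReal)) atTop := by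
  obtain ⟨H, hH, hcount⟩ := h.exists_half_le_mul_oddZeroCount
  have hH0 : 0 < H := by linarith
  -- The count at `(T - H)/2` gives at least `(T - H)/(4H) ≥ T/(6H)` zeros once `T ≥ 3H`; the
  -- smaller constant makes the inequality strict.
  refine ⟨1 / (8 * H), by positivity, ?_⟩
  have hlt : ((1 / (8 * H) : ℝ) : EReal) < ((1 / (6 * H) : ℝ) : EReal) := by
    rw [EReal.coe_lt_coe_iff]
    exact one_div_lt_one_div_of_lt (by positivity) (by linarith)
  refine hlt.trans_le (le_liminf_of_le (by isBoundedDefault) ?_)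
  filter_upwards [eventually_ge_atTop (3 * H)] with T hT
  rw [EReal.coe_le_coe_iff, div_le_div_iff₀ (by positivity) (by linarith)]
  have h1 := hcount ((T - H) / 2) (by linarith)
  rw [show 2 * ((T - H) / 2) + H = T by ring] at h1
  linarith

end IsRotatedMellin

end FrickeZeros

open FrickeZeros in
theorem mainTheorem5 (N : ℕ) [NeZero N] (hN : IsSquare N) (k : ℤ) (hk : 0 < k)
    (f : Cusp N k)
    (hf : (∀ n : ℕ, (coeff f n).im = 0) ∨ (∀ n : ℕ, (coeff f n).re = 0))
    (ε : ℂ) (hε : ε = 1 ∨ ε = -1)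
    (hne : ∃ s : ℂ, LFun hk f s + ε * LFun hk (fricke f) s ≠ 0) :
    ∃ d : ℝ, 0 < d ∧
      (d : EReal) < Filter.liminf (fun T : ℝ =>
        (((oddZeroCount (fun s => LFun hk f s + ε * LFun hk (fricke f) s) ((k : ℝ) / 2) T : ℝ)
          / T : ℝ) : EReal)) Filter.atTop :=
  (isRotatedMellin hk f hf hε hne).exists_lt_liminf_oddZeroCount
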